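/- **Notation.** Let $s_\lambda$ be the Schur functions and $s_{\lambda/\mu}$ the skew Schur functions, defined by $\langle s_{\lambda/\mu}, s_\nu\rangle=\langle s_\lambda, s_\mu s_\nu\rangle$ for the standard inner product; let $\lambda^t$ be the transposed partition and $\kappa_\lambda=\sum_{i\ge 1}\lambda_i(\lambda_i-2i+1)$. For a partition $\mu$ let $q^{\mu+\rho}$ be the sequence with $i$-th term $q^{\mu_i-i+1/2}$, $i\ge1$, so that $q^\rho=(q^{-1/2},q^{-3/2},\dots)$; symmetric functions are evaluated on these sequences by expanding in powers of $q^{-1/2}$. The topological vertex and the framed topological vertex with framing $(f_1,f_2,f_3)\in\mathbb{Z}^3$ are $$C_{\mu_1\mu_2\mu_3}=q^{\kappa_{\mu_3}/2}\,s_{\mu_2}(q^\rho)\sum_\eta s_{\mu_1/\eta}(q^{\mu_2^t+\rho})\,s_{\mu_3^t/\eta}(q^{\mu_2+\rho}),$$ $$C^{(f_1,f_2,f_3)}_{\mu_1\mu_2\mu_3}=q^{(f_1\kappa_{\mu_1}+f_2\kappa_{\mu_2}+f_3\kappa_{\mu_3})/2}\,C_{\mu_1\mu_2\mu_3}.$$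 The two-leg topological vertex of $\mathbb{C}^3$ with framing $(-1,0)$ is the series $$Z^{(-1,0)}=\sum_{\mu_1,\mu_2}C^{(-1,0,0)}_{\mu_1\mu_2\emptyset}\,s_{\mu_1}(x)\,s_{\mu_2}(y)$$ over all pairs of partitions, in the completion by degree of $\Lambda\otimes\Lambda$, where $\Lambda$ is the ring of symmetric functions, with $x=(x_1,x_2,\dots)$ the variables of the first factor, $y=(y_1,y_2,\dots)$ those of the second, and scalars extended to contain $\mathbb{Q}(q^{1/2})$. Write $p_1(x)=\sum_i x_i$, $p_1(y)=\sum_i y_i$ and $\{1\}=q^{1/2}-q^{-1/2}$. The Adams operation $\psi_k$ ($k\ge1$) sends $q^{1/2}\mapsto q^{k/2}$, $x_i\mapsto x_i^k$, $y_i\mapsto y_i^k$, and for $F$ without constant term $$\mathrm{Exp}(F)=\exp\Big(\sum_{k\ge1}\frac1k\,\psi_k(F)\Big),\qquad \mathrm{Exp}'(F)=\exp\Big(\sum_{k\ge1}\frac{(-1)^{k+1}}k\,\psi_k(F)\Big).$$ **Proposition.** The series defining $Z^{(-1,0)}$ converges, and $$Z^{(-1,0)}=\mathrm{Exp}'\!\left(\frac{p_1(x)}{\{1\}}\right)\cdot\mathrm{Exp}\!\left(\frac{p_1(y)}{\{1\}}\right)\cdot\mathrm{Exp}'\big(p_1(x)\,p_1(y)\big).$$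 -/

import Mathlib

open scoped MvPowerSeries.WithPiTopology

namespace TopVertex

noncomputable section

/-! ### Symmetric functions evaluated on an infinite alphabet

A symmetric function is evaluated on a sequence `z 0, z 1, z 2, …` of elements of a topological
commutative ring.  For `z i` the formal variables of a power series ring this gives the symmetric
function itself; for `z i` powers of `q` it gives its specialization.  Partitions are Young
diagrams: `μ.rowLen i` is the part `μ_{i+1}` and `μ.colLen 0` is the number of parts. -/

section SymmetricFunctions

variable {A : Type*} [CommRing A] [TopologicalSpace A]

/-- The power sum `p_k = ∑ i, z i ^ k`. -/
def powerSum (z : ℕ → A) (k : ℕ) : A := ∑' i : ℕ, z i ^ k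

/-- The complete homogeneous symmetric function `h_n`: the sum of all monomials of degree `n`,
where `h_n = 0` for `n < 0`. -/
def completeHomogeneous (z : ℕ → A) (n : ℤ) : A :=
  if n < 0 then 0 else ∑' s : Sym ℕ n.toNat, ((s : Multiset ℕ).map z).prod

/-- The skew Schur function `s_{l/m} = det (h_{l_i - m_j - i + j})`, where the size of the
determinant is any number that is at least the number of parts of `l` and of `m`.
It vanishes unless `m ⊆ l`. -/
def skewSchur (z : ℕ → A) (l m : YoungDiagram) : A :=
  Matrix.det (Matrix.of fun i j : Fin (max (l.colLen 0) (m.colLen 0)) =>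
    completeHomogeneous z ((l.rowLen i : ℤ) - (m.rowLen j : ℤ) - (i : ℤ) + (j : ℤ)))

/-- The Schur function `s_l = s_{l/∅}`. -/
def schur (z : ℕ → A) (l : YoungDiagram) : A := skewSchur z l ⊥

end SymmetricFunctions

/-! ### The topological vertex -/

/-- The coefficient field `ℚ((q^{-1/2}))`, which contains `ℚ(q^{1/2})`.  Its variable is `q^{-1/2}`;
it carries the topology in which the powers of `q^{-1/2}` tend to `0`. -/
abbrev Coeff : Type := LaurentSeries ℚ

/-- The element `q^{1/2}`. -/
def qHalf : Coeff := HahnSeries.single (-1 : ℤ) (1 : ℚ)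

/-- The quantum integer `{n} = q^{n/2} - q^{-n/2}`. -/
def qInt (n : ℤ) : Coeff := qHalf ^ n - qHalf ^ (-n)

/-- `κ_l = ∑ i ≥ 1, l_i (l_i - 2 i + 1)`. -/
def kappa (l : YoungDiagram) : ℤ :=
  ∑ i ∈ Finset.range (l.colLen 0), (l.rowLen i : ℤ) * ((l.rowLen i : ℤ) - 2 * ((i : ℤ) + 1) + 1)

/-- The alphabet `q^{l + ρ}`: its `i`-th letter, counted from `i = 1`, is `q^{l_i - i + 1/2}`.
In particular `qRho ⊥` is `q^ρ = (q^{-1/2}, q^{-3/2}, …)`. -/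
def qRho (l : YoungDiagram) (i : ℕ) : Coeff :=
  qHalf ^ (2 * (l.rowLen i : ℤ) - 2 * ((i : ℤ) + 1) + 1)

/-- The topological vertex
`C_{l m n} = q^{κ_n/2} s_m(q^ρ) ∑_η s_{l/η}(q^{m^t + ρ}) s_{n^t/η}(q^{m + ρ})`.
Only the finitely many `η` contained in `l` and in `n^t` contribute to the sum. -/
def vertex (l m n : YoungDiagram) : Coeff :=
  qHalf ^ kappa n * schur (qRho ⊥) m *
    ∑ᶠ η : YoungDiagram, skewSchur (qRho m.transpose) l η * skewSchur (qRho m) n.transpose η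

/-- The framed topological vertex
`C_{l m n}^{(a, b, c)} = q^{a κ_l/2 + b κ_m/2 + c κ_n/2} C_{l m n}`. -/
def framedVertex (a b c : ℤ) (l m n : YoungDiagram) : Coeff :=
  qHalf ^ (a * kappa l + b * kappa m + c * kappa n) * vertex l m n

/-! ### Two sets of variables and plethystic exponentials -/

/-- Formal power series in `x_0, x_1, …` and `y_0, y_1, …` over `ℚ((q^{-1/2}))`.  It contains the
completion (by degree) of the tensor square of the ring of symmetric functions. -/
abbrev Series : Type := MvPowerSeries (ℕ ⊕ ℕ) Coeff

/-- The variables `x_i`. -/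
def varX (i : ℕ) : Series := MvPowerSeries.X (Sum.inl i)

/-- The variables `y_i`. -/
def varY (i : ℕ) : Series := MvPowerSeries.X (Sum.inr i)

theorem mulLeft_injective (k : ℕ+) : Function.Injective (AddMonoidHom.mulLeft (k : ℤ)) :=
  fun _ _ h => mul_left_cancel₀ (by exact_mod_cast k.ne_zero) h

theorem mulLeft_le_mulLeft_iff (k : ℕ+) (a b : ℤ) :
    AddMonoidHom.mulLeft (k : ℤ) a ≤ AddMonoidHom.mulLeft (k : ℤ) b ↔ a ≤ b :=
  mul_le_mul_iff_right₀ (by exact_mod_cast k.pos)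

/-- The Adams operation on coefficients: `q^{1/2} ↦ q^{k/2}`. -/
def adamsCoeff (k : ℕ+) : Coeff →+* Coeff :=
  HahnSeries.embDomainRingHom (AddMonoidHom.mulLeft (k : ℤ)) (mulLeft_injective k)
    (mulLeft_le_mulLeft_iff k)

/-- The Adams operation `ψ_k`: `q^{1/2} ↦ q^{k/2}`, `x_i ↦ x_i ^ k`, `y_i ↦ y_i ^ k`.  In
particular `p_n ↦ p_{k n}` for the power sums in `x` and in `y`. -/
def adams (k : ℕ+) : Series →+* Series :=
  (MvPowerSeries.expand (k : ℕ) k.ne_zero).toRingHom.comp (MvPowerSeries.map (adamsCoeff k))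

/-- `exp F = ∑ n, F ^ n / n!`, for `F` without constant term. -/
def expSeries (F : Series) : Series := (PowerSeries.exp Coeff).subst F

/-- `Exp(F) = exp (∑ k ≥ 1, ψ_k(F) / k)`, for `F` without constant term. -/
def plethysticExp (F : Series) : Series :=
  expSeries (∑' k : ℕ+, ((k : ℕ) : Coeff)⁻¹ • adams k F)

/-- `Exp'(F) = exp (∑ k ≥ 1, (-1)^(k+1) ψ_k(F) / k)`, for `F` without constant term. -/
def plethysticExp' (F : Series) : Series :=
  expSeries (∑' k : ℕ+, ((-1) ^ ((k : ℕ) + 1) * ((k : ℕ) : Coeff)⁻¹) • adams k F)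

/-- The term `C_{l m ∅}^{(a, b, 0)} s_l(x) s_m(y)` of the two-leg partition function. -/
def twoLegTerm (a b : ℤ) (lm : YoungDiagram × YoungDiagram) : Series :=
  framedVertex a b 0 lm.1 lm.2 ⊥ • (schur varX lm.1 * schur varY lm.2)

/-- The two-leg topological vertex of `ℂ³` with framing `(a, b)`,
`Z^{(a, b)} = ∑_{l, m} C_{l m ∅}^{(a, b, 0)} s_l(x) s_m(y)`. -/
def twoLegVertex (a b : ℤ) : Series := ∑' lm : YoungDiagram × YoungDiagram, twoLegTerm a b lm

end

end TopVertex

namespace TopVertex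

noncomputable section

/-! ### Young diagrams as sets of cells -/

section Diagrams

/-! Write T = q^{-1/2}. With an empty third leg only η = ∅ survives in the vertex, so the framed
vertex is q^{-κ_l/2} s_m(q^ρ) s_l(q^{m^t+ρ}). The heart of the proof is that this equals ∑_η
s_{m/η}(q^ρ) s_{l^t/η}(q^ρ) (`framedVertex_eq_sum`). Granting it, Z becomes a sum over triples (η,
l, m). A monomial fixes |l| and |m| and bounds |η|, so the triple sum converges and may be
reordered. For fixed η, the skew Cauchy identity in y and its dual in x give Exp(p_1(y)/{1}) s_η(y)
and Exp'(p_1(x)/{1}) s_{η^t}(x), because ψ_k(1/{1}) = 1/{k} = p_k(q^ρ). The remaining sum over η is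
the dual Cauchy identity, with value Exp'(p_1(x) p_1(y)).

For the key identity, diagrams with at most n rows are encoded by strictly decreasing sequences β =
λ + δ. Cauchy–Binet (`cauchyBinet`) turns ∑_η into one determinant with entries ∑_k h_{a-k} h_{b-k},
where h = h(q^ρ), a runs over β(m) and b over β(l^t). Each entry is T^{-b(b+1)} h_a times the
coefficient of X^b in E(X)/(1 + T^{2a+1} X), with E the generating series of the e_k(q^ρ)
(`sum_zcoeff_mul_eq`). A determinant of coefficients of F/(1 - w_i X) is a Vandermonde alternant
times a Jacobi–Trudi determinant (`det_coeff_mul_geom`). Apart from the power T^{κ_l}, the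
prefactors do not involve l; the case l = ∅ identifies them with s_m(q^ρ).

The remaining determinant is s_l(q^{m^t+ρ}) by Jacobi–Trudi duality (`jacobiTrudi_transpose`): the
letters of q^{m^t+ρ} and the n letters attached to m are the holes and particles of one Maya
diagram, and together form q^n · q^ρ (`hSeries_qRho_transpose`).

All Cauchy identities come from `hasSum_mul_schur`: Cauchy–Binet in finitely many variables,
division by the Vandermonde alternant, and a coefficientwise limit. -/

theorem rowLen_eq_zero_of_le {l : YoungDiagram} {i : ℕ} (h : l.colLen 0 ≤ i) : l.rowLen i = 0 := by
  by_contra h0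
  have : (i, 0) ∈ l := YoungDiagram.mem_iff_lt_rowLen.2 (Nat.pos_of_ne_zero h0)
  have := YoungDiagram.mem_iff_lt_colLen.1 this
  omega

theorem lt_rowLen_iff_lt_colLen {l : YoungDiagram} {i j : ℕ} : j < l.rowLen i ↔ i < l.colLen j := by
  rw [← YoungDiagram.mem_iff_lt_rowLen, YoungDiagram.mem_iff_lt_colLen]

theorem eq_of_rowLen_eq {l m : YoungDiagram} (h : ∀ i, l.rowLen i = m.rowLen i) : l = m := by
  ext ⟨i, j⟩
  simp [YoungDiagram.mem_iff_lt_rowLen, h]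

@[simp]
theorem rowLen_bot (i : ℕ) : (⊥ : YoungDiagram).rowLen i = 0 := by
  by_contra h
  exact YoungDiagram.notMem_bot (i, 0)
    (YoungDiagram.mem_iff_lt_rowLen.2 (Nat.pos_of_ne_zero h))

@[simp]
theorem colLen_bot (i : ℕ) : (⊥ : YoungDiagram).colLen i = 0 := by
  by_contra h
  exact YoungDiagram.notMem_bot (0, i)
    (YoungDiagram.mem_iff_lt_colLen.2 (Nat.pos_of_ne_zero h))

@[simp]
theorem transpose_bot : (⊥ : YoungDiagram).transpose = ⊥ :=
  eq_of_rowLen_eq fun i => by simp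

theorem sum_cells_eq {M : Type*} [AddCommMonoid M] (l : YoungDiagram) {n : ℕ}
    (hn : l.colLen 0 ≤ n) (g : ℕ × ℕ → M) :
    ∑ c ∈ l.cells, g c = ∑ i ∈ Finset.range n, ∑ j ∈ Finset.range (l.rowLen i), g (i, j) := by
  rw [Finset.sum_sigma']
  refine Finset.sum_nbij' (fun c => ⟨c.1, c.2⟩) (fun c => (c.1, c.2)) ?_ ?_ ?_ ?_ ?_
  · rintro ⟨i, j⟩ hc
    have h1 : (i, j) ∈ l := hc
    have h2 := YoungDiagram.mem_iff_lt_rowLen.1 h1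
    have h3 := YoungDiagram.mem_iff_lt_colLen.1 (l.up_left_mem le_rfl (Nat.zero_le j) h1)
    simp only [Finset.mem_sigma, Finset.mem_range]
    omega
  · rintro ⟨i, j⟩ hc
    simp only [Finset.mem_sigma, Finset.mem_range] at hc
    exact YoungDiagram.mem_iff_lt_rowLen.2 hc.2
  · rintro ⟨i, j⟩ _; rfl
  · rintro ⟨i, j⟩ _; rfl
  · rintro ⟨i, j⟩ _; rfl

theorem card_eq_sum_rowLen (l : YoungDiagram) {n : ℕ} (hn : l.colLen 0 ≤ n) :
    l.card = ∑ i ∈ Finset.range n, l.rowLen i := by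
  have := sum_cells_eq l hn (fun _ => 1)
  simpa using this

theorem card_transpose (l : YoungDiagram) : l.transpose.card = l.card := by
  refine Finset.card_bij' (fun c _ => c.swap) (fun c _ => c.swap) ?_ ?_ ?_ ?_
  · intro c hc; exact YoungDiagram.mem_transpose.1 hc
  · intro c hc; exact YoungDiagram.mem_transpose.2 (by simpa using hc)
  · intro c _; simp
  · intro c _; simp

theorem colLen_zero_le_card (l : YoungDiagram) : l.colLen 0 ≤ l.card := by
  rw [card_eq_sum_rowLen l le_rfl]
  calc l.colLen 0 = ∑ i ∈ Finset.range (l.colLen 0), 1 := by simp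
    _ ≤ _ := Finset.sum_le_sum fun i hi =>
      lt_rowLen_iff_lt_colLen.2 (Finset.mem_range.1 hi)

theorem rowLen_zero_le_card (l : YoungDiagram) : l.rowLen 0 ≤ l.card := by
  have := colLen_zero_le_card l.transpose
  rwa [YoungDiagram.colLen_transpose, card_transpose] at this

theorem eq_bot_of_card_le_zero {l : YoungDiagram} (h : l.card ≤ 0) : l = ⊥ := by
  ext c
  have : l.cells = ∅ := Finset.card_eq_zero.1 (Nat.le_zero.1 h)
  simp [this]

theorem finite_setOf_card_le (n : ℕ) : {l : YoungDiagram | l.card ≤ n}.Finite := by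
  refine Set.Finite.of_finite_image (f := YoungDiagram.cells)
    (Set.Finite.subset (Finset.finite_toSet (Finset.range n ×ˢ Finset.range n).powerset) ?_)
    (fun a _ b _ h => YoungDiagram.ext h)
  rintro _ ⟨l, hl, rfl⟩
  simp only [Finset.coe_powerset, Set.mem_preimage, Set.mem_powerset_iff, Finset.coe_subset]
  rintro ⟨i, j⟩ hc
  have h1 : (i, j) ∈ l := hc
  have h2 := YoungDiagram.mem_iff_lt_rowLen.1 (l.up_left_mem (Nat.zero_le i) le_rfl h1)
  have h3 := YoungDiagram.mem_iff_lt_colLen.1 (l.up_left_mem le_rfl (Nat.zero_le j) h1)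
  have := colLen_zero_le_card l
  have := rowLen_zero_le_card l
  have hl : l.card ≤ n := hl
  simp only [Finset.mem_product, Finset.mem_range]
  omega

theorem sum_range_content (r : ℕ) (i : ℤ) :
    ∑ j ∈ Finset.range r, 2 * ((j : ℤ) - i) = r * (r - 2 * (i + 1) + 1) := by
  induction r with
  | zero => simp
  | succ r ih => rw [Finset.sum_range_succ, ih]; push_cast; ring

theorem kappa_eq_sum_cells (l : YoungDiagram) :
    kappa l = ∑ c ∈ l.cells, 2 * ((c.2 : ℤ) - c.1) := by
  rw [sum_cells_eq l le_rfl, kappa]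
  exact Finset.sum_congr rfl fun i _ => (sum_range_content (l.rowLen i) i).symm

theorem kappa_eq_sum_range (l : YoungDiagram) {n : ℕ} (hn : l.colLen 0 ≤ n) :
    kappa l = ∑ i ∈ Finset.range n,
      (l.rowLen i : ℤ) * ((l.rowLen i : ℤ) - 2 * ((i : ℤ) + 1) + 1) := by
  rw [kappa_eq_sum_cells, sum_cells_eq l hn]
  exact Finset.sum_congr rfl fun i _ => sum_range_content (l.rowLen i) i

/-- κ is twice the sum of the contents, and reflection in the diagonal negates contents. -/
theorem kappa_transpose (l : YoungDiagram) : kappa l.transpose = -kappa l := by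
  rw [kappa_eq_sum_cells, kappa_eq_sum_cells, ← Finset.sum_neg_distrib]
  refine Finset.sum_nbij' Prod.swap Prod.swap ?_ ?_ ?_ ?_ ?_
  · intro c hc; exact YoungDiagram.mem_transpose.1 hc
  · intro c hc; exact YoungDiagram.mem_transpose.2 (by simpa using hc)
  · intro c _; simp
  · intro c _; simp
  · intro c _; simp only [Prod.fst_swap, Prod.snd_swap]; ring

/-- The Young diagram whose first `n` rows have lengths `r 0 ≥ r 1 ≥ …`. -/
def ofRows (n : ℕ) (r : ℕ → ℕ) (hr : ∀ i j, i ≤ j → j < n → r j ≤ r i) : YoungDiagram where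
  cells := ((Finset.range n).sigma fun i => Finset.range (r i)).map
    (Equiv.sigmaEquivProd ℕ ℕ).toEmbedding
  isLowerSet := by
    rintro ⟨i, j⟩ ⟨i', j'⟩ h hc
    obtain ⟨h1, h2⟩ := Prod.mk_le_mk.1 h
    simp only [Finset.mem_coe, Finset.mem_map, Finset.mem_sigma, Finset.mem_range,
      Equiv.coe_toEmbedding, Equiv.sigmaEquivProd_apply, Sigma.exists, Prod.mk.injEq] at hc ⊢
    obtain ⟨a, b, ⟨ha, hb⟩, rfl, rfl⟩ := hc
    exact ⟨i', j', ⟨by omega, by have := hr i' a h1 ha; omega⟩, rfl, rfl⟩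

theorem mem_ofRows {n : ℕ} {r : ℕ → ℕ} {hr} {i j : ℕ} :
    (i, j) ∈ ofRows n r hr ↔ i < n ∧ j < r i := by
  rw [← YoungDiagram.mem_cells]
  simp only [ofRows, Finset.mem_map, Finset.mem_sigma, Finset.mem_range,
      Equiv.coe_toEmbedding, Equiv.sigmaEquivProd_apply, Sigma.exists, Prod.mk.injEq]
  constructor
  · rintro ⟨a, b, h, rfl, rfl⟩; exact h
  · intro h; exact ⟨i, j, h, rfl, rfl⟩

theorem rowLen_ofRows {n : ℕ} {r : ℕ → ℕ} {hr} {i : ℕ} (hi : i < n) :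
    (ofRows n r hr).rowLen i = r i := by
  apply le_antisymm
  · by_contra h
    push Not at h
    exact lt_irrefl _ (mem_ofRows.1 (YoungDiagram.mem_iff_lt_rowLen.2 h)).2
  · by_contra h
    push Not at h
    exact lt_irrefl _ (YoungDiagram.mem_iff_lt_rowLen.1 (mem_ofRows.2 ⟨hi, h⟩))

theorem colLen_ofRows_le {n : ℕ} {r : ℕ → ℕ} {hr} : (ofRows n r hr).colLen 0 ≤ n := by
  by_contra h
  push Not at h
  exact lt_irrefl _ (mem_ofRows.1 (YoungDiagram.mem_iff_lt_colLen.2 h)).1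

end Diagrams

/-! ### Strictly decreasing sequences and the Cauchy–Binet formula -/

section CauchyBinet

/-- The strictly decreasing sequence `l_i + n - 1 - i`, `i < n`, attached to a diagram. -/
def beta (n : ℕ) (l : YoungDiagram) (i : Fin n) : ℕ := l.rowLen i + (n - 1 - i)

theorem beta_strictAnti (n : ℕ) (l : YoungDiagram) : StrictAnti (beta n l) := by
  intro i j h
  have h' : (i : ℕ) < j := h
  have := l.rowLen_anti i j h'.le
  have := j.2
  simp only [beta]
  omega

theorem beta_injective (n : ℕ) (l : YoungDiagram) : Function.Injective (beta n l) :=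
  (beta_strictAnti n l).injective

theorem eq_of_beta_eq {n : ℕ} {l m : YoungDiagram} (hl : l.colLen 0 ≤ n) (hm : m.colLen 0 ≤ n)
    (h : beta n l = beta n m) : l = m := by
  apply eq_of_rowLen_eq
  intro i
  by_cases hi : i < n
  · have := congrFun h ⟨i, hi⟩
    simp only [beta] at this
    omega
  · rw [rowLen_eq_zero_of_le (by omega), rowLen_eq_zero_of_le (by omega)]

theorem exists_beta_eq {n : ℕ} {f : Fin n → ℕ} (hf : StrictAnti f) :
    ∃ l : YoungDiagram, l.colLen 0 ≤ n ∧ beta n l = f := by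
  -- A strictly decreasing sequence drops by at least one per step. Compared with the last entry
  -- this gives f i ≥ n - 1 - i, so the staircase can be subtracted without truncation.
  have key : ∀ d : ℕ, ∀ i j : Fin n, (i : ℕ) + d = j → f j + d ≤ f i := by
    intro d
    induction d with
    | zero => 
      intro i j h
      obtain rfl : i = j := Fin.ext (by omega)
      rfl
    | succ d ih =>
      intro i j h
      have h1 := ih i ⟨i + d, by omega⟩ rfl
      have hj := j.2
      have h2 : f j < f ⟨i + d, by omega⟩ := hf (Fin.lt_def.2 (by simp only; omega))
      omega
  have low : ∀ i : Fin n, n - 1 - (i : ℕ) ≤ f i := by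
    intro i
    have hi := i.2
    have := key (n - 1 - i) i ⟨n - 1, by omega⟩ (by simp only; omega)
    omega
  refine ⟨ofRows n (fun i => if h : i < n then f ⟨i, h⟩ - (n - 1 - i) else 0) ?_,
    colLen_ofRows_le, ?_⟩
  · intro i j hij hj
    have h1 := key (j - i) ⟨i, by omega⟩ ⟨j, hj⟩ (by simp only; omega)
    have h2 := low ⟨j, hj⟩
    simp only [hj, lt_of_le_of_lt hij hj, dif_pos] at h2 ⊢
    omega
  · funext i
    have := low i
    simp only [beta, rowLen_ofRows i.2, i.2, dif_pos, Fin.eta]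
    omega

/-- The diagrams with at most `n` rows for which `beta n` takes values less than `N`. -/
def boxDiagrams (n N : ℕ) : Finset YoungDiagram :=
  Set.Finite.toFinset (s := {l : YoungDiagram | l.colLen 0 ≤ n ∧ ∀ i : Fin n, beta n l i < N})
    (by
      refine (finite_setOf_card_le (n * N)).subset ?_
      rintro l ⟨h1, h2⟩
      have h3 : ∀ i ∈ Finset.range n, l.rowLen i ≤ N := by
        intro i hi
        have := h2 ⟨i, Finset.mem_range.1 hi⟩
        simp only [beta] at this
        omega
      have := Finset.sum_le_card_nsmul _ _ _ h3
      rw [← card_eq_sum_rowLen l h1] at this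
      simpa using this)

theorem mem_boxDiagrams {n N : ℕ} {l : YoungDiagram} :
    l ∈ boxDiagrams n N ↔ l.colLen 0 ≤ n ∧ ∀ i : Fin n, beta n l i < N := by
  simp [boxDiagrams]

theorem exists_perm_strictAnti {n : ℕ} {f : Fin n → ℕ} (hf : Function.Injective f) :
    ∃ σ : Equiv.Perm (Fin n), StrictAnti (f ∘ σ) := by
  refine ⟨Fin.revPerm.trans (Tuple.sort f), ?_⟩
  have h : StrictMono (f ∘ Tuple.sort f) :=
    (Tuple.monotone_sort f).strictMono_of_injective (hf.comp (Tuple.sort f).injective)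
  intro i j hij
  exact h (Fin.rev_lt_rev.2 hij)

/-- The only order-preserving permutation of `Fin n` is the identity, so an injective sequence
determines both its sorted form and the sorting permutation. -/
theorem perm_eq_of_strictAnti_comp {n : ℕ} {f g : Fin n → ℕ} (hf : StrictAnti f)
    (hg : StrictAnti g) {σ τ : Equiv.Perm (Fin n)} (h : f ∘ σ = g ∘ τ) : f = g ∧ σ = τ := by
  have h1 : f ∘ (τ.symm.trans σ) = g := by
    funext i
    have := congrFun h (τ.symm i)
    simpa using this
  have h2 : StrictMono (τ.symm.trans σ) := by
    intro i j hij
    have : g j < g i := hg hij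
    rw [← h1] at this
    exact hf.lt_iff_gt.1 this
  have h3 : τ.symm.trans σ = Equiv.refl _ := by
    have := Subsingleton.elim (h2.orderIsoOfSurjective _ (Equiv.surjective _)) (OrderIso.refl _)
    ext i
    have h4 := congrArg (fun e : Fin n ≃o Fin n => ((e i : Fin n) : ℕ)) this
    simpa using h4
  constructor
  · rw [← h1, h3]; rfl
  · ext i
    have := congrArg (fun e : Equiv.Perm (Fin n) => ((e (τ i) : Fin n) : ℕ)) h3
    simpa using this

/-- Sorting matches injective sequences below N with pairs (diagram, permutation); `hF` discards the
other sequences, as an alternating form does. -/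
theorem sum_piFinset_eq_sum_boxDiagrams {M : Type*} [AddCommMonoid M] (n N : ℕ)
    (F : (Fin n → ℕ) → M) (hF : ∀ f, ¬ Function.Injective f → F f = 0) :
    ∑ f ∈ Fintype.piFinset (fun _ : Fin n => Finset.range N), F f =
      ∑ l ∈ boxDiagrams n N, ∑ σ : Equiv.Perm (Fin n), F (beta n l ∘ σ) := by
  rw [← Finset.sum_product']
  symm
  refine Finset.sum_of_injOn (fun p => beta n p.1 ∘ p.2) ?_ ?_ ?_ ?_
  · rintro ⟨l, σ⟩ hl ⟨m, τ⟩ hm h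
    simp only [Finset.coe_product, Set.mem_prod, Finset.mem_coe, mem_boxDiagrams] at hl hm
    obtain ⟨h1, h2⟩ := perm_eq_of_strictAnti_comp (beta_strictAnti n l) (beta_strictAnti n m) h
    exact Prod.ext (eq_of_beta_eq hl.1.1 hm.1.1 h1) h2
  · rintro ⟨l, σ⟩ hl
    simp only [Finset.coe_product, Set.mem_prod, Finset.mem_coe, mem_boxDiagrams] at hl
    simp only [Finset.mem_coe, Fintype.mem_piFinset, Finset.mem_range]
    exact fun i => hl.1.2 (σ i)
  · intro f hf hnot
    apply hF
    intro hinj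
    apply hnot
    obtain ⟨σ, hσ⟩ := exists_perm_strictAnti hinj
    obtain ⟨l, hl, hb⟩ := exists_beta_eq hσ
    simp only [Fintype.mem_piFinset, Finset.mem_range] at hf
    refine ⟨(l, σ.symm), ?_, ?_⟩
    · simp only [Finset.coe_product, Set.mem_prod, Finset.mem_coe, mem_boxDiagrams]
      refine ⟨⟨hl, fun i => ?_⟩, by simp⟩
      rw [hb]
      exact hf _
    · simp only [hb]
      funext i
      simp
  · rintro ⟨l, σ⟩ _
    rfl

/-- The Cauchy–Binet formula, with the minors indexed by Young diagrams in a box. -/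
theorem cauchyBinet {R : Type*} [CommRing R] (n N : ℕ) (A : Fin n → ℕ → R) (B : ℕ → Fin n → R) :
    ∑ l ∈ boxDiagrams n N, (Matrix.of fun i j => A i (beta n l j)).det *
      (Matrix.of fun i j => B (beta n l i) j).det =
    (Matrix.of fun i j => ∑ a ∈ Finset.range N, A i a * B a j).det := by
  have h1 : (Matrix.of fun i j => ∑ a ∈ Finset.range N, A i a * B a j) =
      fun i => ∑ a ∈ Finset.range N, A i a • B a := by
    funext i j
    simp
  rw [h1]
  -- Each row is a combination of the rows of `B`, so multilinearity expands the determinant over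
  -- all choices of one index per row.
  change _ = (Matrix.detRowAlternating (R := R)).toMultilinearMap _
  rw [MultilinearMap.map_sum_finset]
  simp_rw [MultilinearMap.map_smul_univ]
  rw [sum_piFinset_eq_sum_boxDiagrams]
  · refine Finset.sum_congr rfl fun l _ => ?_
    rw [← Matrix.det_transpose, Matrix.det_apply', Finset.sum_mul]
    refine Finset.sum_congr rfl fun σ _ => ?_
    have : (Matrix.detRowAlternating (R := R)) (fun i => B ((beta n l ∘ σ) i)) =
        Equiv.Perm.sign σ * (Matrix.of fun i j => B (beta n l i) j).det := by
      rw [← Matrix.det_permute]; rfl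
    rw [AlternatingMap.coe_multilinearMap, this]
    simp only [Matrix.transpose_apply, Matrix.of_apply, Function.comp, smul_eq_mul]
    ring
  · intro f hf
    obtain ⟨i, j, hij, hne⟩ : ∃ i j, f i = f j ∧ i ≠ j := by
      simpa [Function.Injective] using hf
    rw [AlternatingMap.coe_multilinearMap,
      AlternatingMap.map_eq_zero_of_eq _ (fun i => B (f i)) (congrArg B hij) hne, smul_zero]

end CauchyBinet

/-! ### Jacobi–Trudi determinants -/

section JacobiTrudi

open PowerSeries

variable {R : Type*} [CommRing R]

/-- The coefficient of a power series at an integer, zero at negative integers. -/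
def zcoeff (F : PowerSeries R) (k : ℤ) : R := if k < 0 then 0 else coeff k.toNat F

theorem zcoeff_of_neg (F : PowerSeries R) {k : ℤ} (h : k < 0) : zcoeff F k = 0 := if_pos h

@[simp]
theorem zcoeff_natCast (F : PowerSeries R) (k : ℕ) : zcoeff F k = coeff k F := by
  simp [zcoeff]

theorem zcoeff_zero (F : PowerSeries R) : zcoeff F 0 = constantCoeff F := by
  simp [zcoeff]

theorem zcoeff_sub_of_le (F : PowerSeries R) {a b : ℕ} (h : b ≤ a) :
    zcoeff F ((a : ℤ) - b) = coeff (a - b) F := by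
  rw [← zcoeff_natCast, Nat.cast_sub h]

theorem zcoeff_sub_of_lt (F : PowerSeries R) {a b : ℕ} (h : a < b) :
    zcoeff F ((a : ℤ) - b) = 0 := zcoeff_of_neg F (by omega)

theorem zcoeff_one (k : ℤ) : zcoeff (1 : PowerSeries R) k = if k = 0 then 1 else 0 := by
  by_cases h : k < 0
  · rw [zcoeff_of_neg _ h, if_neg (by omega)]
  · obtain ⟨a, rfl⟩ := Int.eq_ofNat_of_zero_le (not_lt.1 h)
    rw [zcoeff_natCast, coeff_one]
    simp

/-- Multiplicativity of Toeplitz matrices: entries with r > p vanish, so a window N > p already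
contains the whole convolution. -/
theorem sum_zcoeff_mul_zcoeff (F G : PowerSeries R) {N p q : ℕ} (hp : p < N) :
    ∑ r ∈ Finset.range N, zcoeff F ((p : ℤ) - r) * zcoeff G ((r : ℤ) - q) =
      zcoeff (F * G) ((p : ℤ) - q) := by
  by_cases h : p < q
  · rw [zcoeff_sub_of_lt _ h]
    refine Finset.sum_eq_zero fun r _ => ?_
    by_cases hr : p < r
    · rw [zcoeff_sub_of_lt _ hr, zero_mul]
    · rw [zcoeff_sub_of_lt (a := r) _ (by omega), mul_zero]
  · rw [zcoeff_sub_of_le _ (not_lt.1 h), coeff_mul]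
    symm
    refine Finset.sum_of_injOn (fun x => q + x.2) ?_ ?_ ?_ ?_
    · rintro ⟨a, b⟩ hx ⟨a', b'⟩ hx' h
      have hx := Finset.HasAntidiagonal.mem_antidiagonal.1 (Finset.mem_coe.1 hx)
      have hx' := Finset.HasAntidiagonal.mem_antidiagonal.1 (Finset.mem_coe.1 hx')
      simp only at hx hx' h
      exact Prod.ext (by simp only; omega) (by simp only; omega)
    · rintro ⟨a, b⟩ hx
      have hx := Finset.HasAntidiagonal.mem_antidiagonal.1 (Finset.mem_coe.1 hx)
      simp only [Finset.mem_coe, Finset.mem_range] at hx ⊢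
      omega
    · intro r hr hn
      by_cases h1 : p < r
      · rw [zcoeff_sub_of_lt _ h1, zero_mul]
      by_cases h2 : r < q
      · rw [zcoeff_sub_of_lt _ h2, mul_zero]
      refine absurd ⟨(p - r, r - q), ?_, ?_⟩ hn
      · exact Finset.mem_coe.2 (Finset.HasAntidiagonal.mem_antidiagonal.2 (by omega))
      · simp only; omega
    · rintro ⟨a, b⟩ hx
      have hx := Finset.HasAntidiagonal.mem_antidiagonal.1 hx
      simp only at hx
      rw [show (p : ℤ) - ((q + b : ℕ) : ℤ) = (a : ℕ) by omega,
        show ((q + b : ℕ) : ℤ) - q = (b : ℕ) by omega, zcoeff_natCast, zcoeff_natCast]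

/-- The sign is written with a + b, which has the parity of a - b, so that it later splits into a
row and a column factor. -/
theorem zcoeff_evalNegHom (F : PowerSeries R) (a b : ℕ) :
    zcoeff (evalNegHom F) ((a : ℤ) - b) = (-1) ^ (a + b) * zcoeff F ((a : ℤ) - b) := by
  by_cases h : a < b
  · rw [zcoeff_sub_of_lt _ h, zcoeff_sub_of_lt _ h, mul_zero]
  · obtain ⟨c, rfl⟩ := Nat.exists_eq_add_of_le (not_lt.1 h)
    rw [zcoeff_sub_of_le _ (by omega), zcoeff_sub_of_le _ (by omega), evalNegHom, coeff_rescale,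
      Nat.add_sub_cancel_left, show b + c + b = c + 2 * b by ring, pow_add, pow_mul]
    simp

/-- The Jacobi–Trudi determinant of size `n` for the skew shape `l / m`, where the coefficients
of `F` play the role of the complete homogeneous symmetric functions. -/
def jacobiTrudi (F : PowerSeries R) (n : ℕ) (l m : YoungDiagram) : R :=
  Matrix.det (Matrix.of fun i j : Fin n =>
    zcoeff F ((l.rowLen i : ℤ) - (m.rowLen j : ℤ) - (i : ℤ) + (j : ℤ)))

theorem jacobiTrudi_eq_det_beta (F : PowerSeries R) (n : ℕ) (l m : YoungDiagram) :
    jacobiTrudi F n l m =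
      Matrix.det (Matrix.of fun i j : Fin n => zcoeff F ((beta n l i : ℤ) - beta n m j)) := by
  rw [jacobiTrudi]
  congr 2
  funext i j
  congr 1
  have := i.2
  have := j.2
  simp only [beta]
  omega

/-- The extra row is 0, …, 0, 1. Determinants of different sizes may therefore be compared freely.
-/
theorem jacobiTrudi_succ {F : PowerSeries R} (hF : constantCoeff F = 1) {n : ℕ}
    {l m : YoungDiagram} (hl : l.colLen 0 ≤ n) (hm : m.colLen 0 ≤ n) :
    jacobiTrudi F (n + 1) l m = jacobiTrudi F n l m := by
  rw [jacobiTrudi, Matrix.det_succ_row _ (Fin.last n), Finset.sum_eq_single (Fin.last n)]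
  · simp only [Fin.val_last, Matrix.of_apply, rowLen_eq_zero_of_le hl, rowLen_eq_zero_of_le hm]
    rw [show ((0 : ℕ) : ℤ) - (0 : ℕ) - n + n = 0 by ring, zcoeff_zero, hF, jacobiTrudi,
      Even.neg_one_pow ⟨n, rfl⟩, one_mul, one_mul]
    congr 1
    ext i j
    simp
  · intro j _ hj
    have : (j : ℕ) < n := Fin.val_lt_last hj
    rw [Matrix.of_apply, zcoeff_of_neg, mul_zero, zero_mul]
    simp only [Fin.val_last, rowLen_eq_zero_of_le hl]
    omega
  · simp

theorem jacobiTrudi_eq_of_le {F : PowerSeries R} (hF : constantCoeff F = 1) {n N : ℕ}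
    {l m : YoungDiagram} (hl : l.colLen 0 ≤ n) (hm : m.colLen 0 ≤ n) (h : n ≤ N) :
    jacobiTrudi F N l m = jacobiTrudi F n l m := by
  induction N, h using Nat.le_induction with
  | base => rfl
  | succ N h ih => rw [jacobiTrudi_succ hF (by omega) (by omega), ih]

theorem jacobiTrudi_bot_bot {F : PowerSeries R} (hF : constantCoeff F = 1) (n : ℕ) :
    jacobiTrudi F n ⊥ ⊥ = 1 := by
  rw [jacobiTrudi_eq_of_le hF (by simp) (by simp) (Nat.zero_le n), jacobiTrudi]
  exact Matrix.det_isEmpty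

/-- A nonzero term in the Leibniz expansion needs β_l(σ i) ≥ β_m(i) for every i; summing over i
would give |l| ≥ |m|. -/
theorem jacobiTrudi_eq_zero_of_card_lt (F : PowerSeries R) {n : ℕ} {l m : YoungDiagram}
    (hl : l.colLen 0 ≤ n) (hm : m.colLen 0 ≤ n) (h : l.card < m.card) :
    jacobiTrudi F n l m = 0 := by
  rw [jacobiTrudi_eq_det_beta, Matrix.det_apply]
  refine Finset.sum_eq_zero fun σ _ => ?_
  suffices ∃ i, beta n l (σ i) < beta n m i by
    obtain ⟨i, hi⟩ := this
    rw [Finset.prod_eq_zero (Finset.mem_univ i), smul_zero]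
    exact zcoeff_sub_of_lt _ hi
  by_contra hcon
  push Not at hcon
  have h1 := Finset.sum_le_sum fun i (_ : i ∈ Finset.univ) => hcon i
  rw [Equiv.sum_comp σ (beta n l)] at h1
  simp only [beta, Finset.sum_add_distrib] at h1
  rw [card_eq_sum_rowLen l hl, card_eq_sum_rowLen m hm, ← Fin.sum_univ_eq_sum_range,
    ← Fin.sum_univ_eq_sum_range] at h
  omega

/-- The alternant `det (w_i ^ b_j)` with exponents `b = l + δ`. -/
def alternant {n : ℕ} (w : Fin n → R) (l : YoungDiagram) : R :=
  Matrix.det (Matrix.of fun i j : Fin n => w i ^ beta n l j)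

/-- The geometric series `1 / (1 - w X)`. -/
def geom (w : R) : PowerSeries R := mk fun k => w ^ k

@[simp]
theorem coeff_geom (w : R) (k : ℕ) : coeff k (geom w) = w ^ k := coeff_mk _ _

theorem constantCoeff_geom (w : R) : constantCoeff (geom w) = 1 := by
  rw [← coeff_zero_eq_constantCoeff_apply, coeff_geom, pow_zero]

theorem one_sub_mul_geom (w : R) : (1 - C w * X) * geom w = 1 := by
  ext k
  cases k with
  | zero => simp [sub_mul, mul_assoc, constantCoeff_geom]
  | succ k => simp [sub_mul, mul_assoc, coeff_succ_X_mul, pow_succ', coeff_one]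

theorem coeff_prod_one_sub_eq_zero {ι : Type*} (s : Finset ι) (w : ι → R) {k : ℕ}
    (hk : s.card < k) : coeff k (∏ i ∈ s, (1 - C (w i) * X)) = 0 := by
  classical
  induction s using Finset.induction_on generalizing k with
  | empty =>
    rw [Finset.card_empty] at hk
    simp [coeff_one, hk.ne']
  | insert a s ha ih =>
    rw [Finset.card_insert_of_notMem ha] at hk
    obtain ⟨k, rfl⟩ : ∃ j, k = j + 1 := ⟨k - 1, by omega⟩
    rw [Finset.prod_insert ha, sub_mul, one_mul, map_sub, ih (by omega), mul_assoc, coeff_C_mul,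
      coeff_succ_X_mul, ih (by omega), mul_zero, sub_zero]

/-- 1/(1 - w_i X) is the full product of geometric series times ∏_{l ≠ i} (1 - w_l X), a polynomial
of degree at most n - 1. Its n coefficients are listed backwards to match the exponents of δ, making
the formula a matrix product. -/
theorem coeff_mul_geom_eq_sum {n : ℕ} (F : PowerSeries R) (w : Fin n → R) (i : Fin n) (b : ℕ) :
    coeff b (F * geom (w i)) = ∑ k : Fin n,
      coeff (n - 1 - (k : ℕ)) (∏ l ∈ Finset.univ.erase i, (1 - C (w l) * X)) *
        zcoeff (F * ∏ l, geom (w l)) ((b : ℤ) - ((n - 1 - (k : ℕ) : ℕ) : ℤ)) := by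
  have h1 : F * geom (w i) = (∏ l ∈ Finset.univ.erase i, (1 - C (w l) * X)) *
      (F * ∏ l, geom (w l)) := by
    rw [← Finset.mul_prod_erase _ _ (Finset.mem_univ i)]
    have : (∏ l ∈ Finset.univ.erase i, (1 - C (w l) * X)) *
        ∏ l ∈ Finset.univ.erase i, geom (w l) = 1 := by
      rw [← Finset.prod_mul_distrib]
      exact Finset.prod_eq_one fun l _ => one_sub_mul_geom _
    linear_combination -(F * geom (w i)) * this
  rw [h1]
  set P := ∏ l ∈ Finset.univ.erase i, (1 - C (w l) * X) with hP
  set G := F * ∏ l, geom (w l)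
  have hn : 0 < n := i.pos
  have hcard : (Finset.univ.erase i).card = n - 1 := by simp
  have h2 : ∀ k, n ≤ k → coeff k P = 0 := fun k hk => by
    rw [hP, coeff_prod_one_sub_eq_zero]
    omega
  rw [← Equiv.sum_comp Fin.revPerm]
  have h3 : ∀ k : Fin n, n - 1 - ((Fin.revPerm k : Fin n) : ℕ) = k := fun k => by
    have := k.2
    simp only [Fin.revPerm_apply, Fin.val_rev]
    omega
  simp_rw [h3]
  rw [Fin.sum_univ_eq_sum_range (fun k => coeff k P * zcoeff G ((b : ℤ) - (k : ℕ))) n, coeff_mul,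
    Finset.Nat.sum_antidiagonal_eq_sum_range_succ_mk]
  have h4 : ∀ k ∈ Finset.range (b + 1),
      coeff k P * coeff (b - k) G = coeff k P * zcoeff G ((b : ℤ) - (k : ℕ)) := fun k hk => by
    rw [zcoeff_sub_of_le _ (by rw [Finset.mem_range] at hk; omega)]
  rw [Finset.sum_congr rfl h4]
  rcases le_total (b + 1) n with h | h
  · refine Finset.sum_subset (Finset.range_mono h) fun k _ hk => ?_
    rw [zcoeff_sub_of_lt _ (by rw [Finset.mem_range] at hk; omega), mul_zero]
  · symm
    refine Finset.sum_subset (Finset.range_mono h) fun k _ hk => ?_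
    rw [h2 k (by rw [Finset.mem_range] at hk; omega), zero_mul]

theorem det_coeff_mul_geom_aux {n : ℕ} (F : PowerSeries R) (w : Fin n → R) (l : YoungDiagram) :
    Matrix.det (Matrix.of fun i j : Fin n => coeff (beta n l j) (F * geom (w i))) =
      Matrix.det (Matrix.of fun i k : Fin n =>
        coeff (n - 1 - (k : ℕ)) (∏ l ∈ Finset.univ.erase i, (1 - C (w l) * X))) *
      jacobiTrudi (F * ∏ l, geom (w l)) n l ⊥ := by
  rw [jacobiTrudi_eq_det_beta, ← Matrix.det_transpose (Matrix.of fun i j : Fin n =>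
    zcoeff _ ((beta n l i : ℤ) - beta n ⊥ j)), ← Matrix.det_mul]
  congr 1
  ext i j
  rw [Matrix.of_apply, coeff_mul_geom_eq_sum, Matrix.mul_apply]
  simp [beta]

theorem alternant_eq_det_coeff {n : ℕ} (w : Fin n → R) (l : YoungDiagram) :
    alternant w l = Matrix.det (Matrix.of fun i j : Fin n => coeff (beta n l j) (1 * geom (w i))) := by
  simp [alternant]

theorem constantCoeff_prod_geom {ι : Type*} (s : Finset ι) (w : ι → R) :
    constantCoeff (∏ i ∈ s, geom (w i)) = 1 := by
  rw [map_prod]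
  exact Finset.prod_eq_one fun i _ => constantCoeff_geom _

/-- The left factor in `det_coeff_mul_geom_aux` depends on neither F nor l, so F = 1 and l = ∅
identify it with the Vandermonde alternant. -/
theorem det_coeff_mul_geom {n : ℕ} (F : PowerSeries R) (w : Fin n → R) (l : YoungDiagram) :
    Matrix.det (Matrix.of fun i j : Fin n => coeff (beta n l j) (F * geom (w i))) =
      alternant w ⊥ * jacobiTrudi (F * ∏ l, geom (w l)) n l ⊥ := by
  rw [det_coeff_mul_geom_aux, alternant_eq_det_coeff, det_coeff_mul_geom_aux, one_mul,
    jacobiTrudi_bot_bot (constantCoeff_prod_geom _ _), mul_one]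

/-- The bialternant formula. -/
theorem alternant_eq_mul_jacobiTrudi {n : ℕ} (w : Fin n → R) (l : YoungDiagram) :
    alternant w l = alternant w ⊥ * jacobiTrudi (∏ l, geom (w l)) n l ⊥ := by
  rw [alternant_eq_det_coeff, det_coeff_mul_geom, one_mul]

end JacobiTrudi

/-! ### Duality of Jacobi–Trudi determinants -/

section Duality

open PowerSeries

variable {n N : ℕ}

theorem beta_lt_add {l : YoungDiagram} (h : l.rowLen 0 ≤ N) (p : Fin n) : beta n l p < n + N := by
  have := l.rowLen_anti 0 p (Nat.zero_le _)
  have := p.2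
  simp only [beta]
  omega

/-- The two complementary sequences `l_{n-1-p} + p` and `n + j - l'_j` that exhaust `0, …, n+N-1`,
as a function. -/
def mayaFun (l : YoungDiagram) (hN : l.rowLen 0 ≤ N) : Fin n ⊕ Fin N → Fin (n + N) :=
  Sum.elim (fun p => ⟨beta n l p.rev, beta_lt_add hN _⟩) fun j => ⟨n + j - l.colLen j, by omega⟩

theorem rowLen_colLen_trichotomy (l : YoungDiagram) (i j : ℕ) :
    (j < l.rowLen i ∧ i < l.colLen j) ∨ (l.rowLen i ≤ j ∧ l.colLen j ≤ i) := by
  have := lt_rowLen_iff_lt_colLen (l := l) (i := i) (j := j)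
  by_cases h : j < l.rowLen i
  · exact Or.inl ⟨h, this.1 h⟩
  · exact Or.inr ⟨not_lt.1 h, not_lt.1 fun h' => h (this.2 h')⟩

/-- The two families are the vertical and horizontal steps of the boundary path of l. A coincidence
between them would put the cell (p, j) both inside and outside l; counting gives surjectivity. -/
theorem mayaFun_bijective (l : YoungDiagram) (hn : l.colLen 0 ≤ n) (hN : l.rowLen 0 ≤ N) :
    Function.Bijective (mayaFun (n := n) l hN) := by
  have hcross : ∀ (p : Fin n) (j : Fin N), beta n l p ≠ n + j - l.colLen j := by
    intro p j h
    have := l.colLen_anti 0 j (Nat.zero_le _)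
    have := p.2
    have := rowLen_colLen_trichotomy l p j
    simp only [beta] at h
    omega
  refine (Fintype.bijective_iff_injective_and_card _).2 ⟨?_, by simp⟩
  rintro (p | j) (p' | j') h
  · have h := congrArg Fin.val h
    simp only [mayaFun, Sum.elim_inl] at h
    rw [Fin.rev_injective (beta_injective n l h)]
  · exact absurd (congrArg Fin.val h) (hcross _ _)
  · exact absurd (congrArg Fin.val h).symm (hcross _ _)
  · have h := congrArg Fin.val h
    simp only [mayaFun, Sum.elim_inr] at h
    have := l.colLen_anti 0 j (Nat.zero_le _)
    have := l.colLen_anti 0 j' (Nat.zero_le _)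
    rcases lt_trichotomy (j : ℕ) j' with hj | hj | hj
    · have := l.colLen_anti j j' hj.le; omega
    · rw [Fin.ext hj]
    · have := l.colLen_anti j' j hj.le; omega

/-- The two complementary sequences `l_{n-1-p} + p` and `n + j - l'_j`. -/
def mayaEquiv (l : YoungDiagram) (hn : l.colLen 0 ≤ n) (hN : l.rowLen 0 ≤ N) :
    Fin n ⊕ Fin N ≃ Fin (n + N) :=
  Equiv.ofBijective _ (mayaFun_bijective l hn hN)

theorem mayaEquiv_inl (l : YoungDiagram) (hn : l.colLen 0 ≤ n) (hN : l.rowLen 0 ≤ N) (p : Fin n) :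
    (mayaEquiv l hn hN (Sum.inl p) : ℕ) = beta n l p.rev := rfl

theorem mayaEquiv_inr (l : YoungDiagram) (hn : l.colLen 0 ≤ n) (hN : l.rowLen 0 ≤ N) (j : Fin N) :
    (mayaEquiv l hn hN (Sum.inr j) : ℕ) = n + j - l.colLen j := rfl

/-- `mayaEquiv` as a permutation. -/
def mayaPerm (l : YoungDiagram) (hn : l.colLen 0 ≤ n) (hN : l.rowLen 0 ≤ N) :
    Equiv.Perm (Fin (n + N)) :=
  finSumFinEquiv.symm.trans (mayaEquiv l hn hN)

theorem castAdd_lt_natAdd (p : Fin n) (j : Fin N) : Fin.castAdd N p < Fin.natAdd n j := by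
  rw [Fin.lt_def, Fin.val_castAdd, Fin.val_natAdd]
  omega

/-- Both blocks are listed increasingly, so an inversion is a particle lying beyond a hole, and such
pairs are exactly the cells of l. -/
theorem sign_mayaPerm (l : YoungDiagram) (hn : l.colLen 0 ≤ n) (hN : l.rowLen 0 ≤ N) :
    Equiv.Perm.sign (mayaPerm l hn hN) = (-1) ^ l.card := by
  set τ := mayaPerm l hn hN with hτ
  have h1 : ∀ p : Fin n, (τ (Fin.castAdd N p) : ℕ) = beta n l p.rev := fun p => by
    simp [hτ, mayaPerm, mayaEquiv_inl]
  have h2 : ∀ j : Fin N, (τ (Fin.natAdd n j) : ℕ) = n + j - l.colLen j := fun j => by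
    simp [hτ, mayaPerm, mayaEquiv_inr]
  have h3 : ∀ i : Fin (n + N), ∏ j ∈ Finset.Ioi i, (if τ i < τ j then (1 : ℤˣ) else -1) =
      ∏ j, if i < j then (if τ i < τ j then (1 : ℤˣ) else -1) else 1 := fun i => by
    rw [← Finset.prod_filter]
    congr 1
    ext j
    simp
  rw [Equiv.Perm.sign_eq_prod_prod_Ioi]
  simp_rw [h3]
  rw [Fin.prod_univ_add]
  have h4 : ∀ p : Fin n, (∏ j, if Fin.castAdd N p < j then
      (if τ (Fin.castAdd N p) < τ j then (1 : ℤˣ) else -1) else 1) =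
      (-1) ^ l.rowLen p.rev := by
    intro p
    rw [Fin.prod_univ_add, Finset.prod_eq_one, one_mul]
    · have h5 : ∀ j : Fin N, (if Fin.castAdd N p < Fin.natAdd n j then
          (if τ (Fin.castAdd N p) < τ (Fin.natAdd n j) then (1 : ℤˣ) else -1) else 1) =
          if (j : ℕ) < l.rowLen p.rev then -1 else 1 := by
        intro j
        rw [if_pos (castAdd_lt_natAdd p j)]
        simp only [Fin.lt_def, h1, h2]
        have := l.colLen_anti 0 j (Nat.zero_le _)
        have := p.rev.2
        have := rowLen_colLen_trichotomy l p.rev j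
        have hb : beta n l p.rev = l.rowLen p.rev + (n - 1 - p.rev) := rfl
        by_cases h : (j : ℕ) < l.rowLen p.rev
        · rw [if_pos h, if_neg (by omega)]
        · rw [if_neg h, if_pos (by omega)]
      simp_rw [h5]
      rw [Fin.prod_univ_eq_prod_range (fun j => if j < l.rowLen p.rev then (-1 : ℤˣ) else 1),
        ← Finset.prod_filter, Finset.prod_const]
      congr 1
      have hle := (l.rowLen_anti 0 p.rev (Nat.zero_le _)).trans hN
      have : Finset.filter (fun j => j < l.rowLen p.rev) (Finset.range N) =
          Finset.range (l.rowLen p.rev) := by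
        ext j
        simp only [Finset.mem_filter, Finset.mem_range]
        omega
      rw [this, Finset.card_range]
    · intro p' _
      by_cases h : p < p'
      · have h6 : τ (Fin.castAdd N p) < τ (Fin.castAdd N p') := by
          rw [Fin.lt_def, h1, h1]
          exact beta_strictAnti n l (Fin.rev_lt_rev.2 h)
        rw [if_pos h6]
        simp
      · rw [if_neg]
        rwa [Fin.lt_def, Fin.val_castAdd, Fin.val_castAdd, ← Fin.lt_def]
  have h7 : ∀ j : Fin N, (∏ k, if Fin.natAdd n j < k then
      (if τ (Fin.natAdd n j) < τ k then (1 : ℤˣ) else -1) else 1) = 1 := by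
    intro j
    rw [Fin.prod_univ_add, Finset.prod_eq_one, one_mul, Finset.prod_eq_one]
    · intro j' _
      by_cases h : j < j'
      · have h6 : τ (Fin.natAdd n j) < τ (Fin.natAdd n j') := by
          rw [Fin.lt_def, h2, h2]
          have h : (j : ℕ) < j' := h
          have := l.colLen_anti 0 j (Nat.zero_le _)
          have := l.colLen_anti j j' h.le
          omega
        rw [if_pos h6]
        simp
      · rw [if_neg]
        simpa using h
    · intro p _
      rw [if_neg]
      exact not_lt.2 (castAdd_lt_natAdd p j).le
  simp_rw [h4, h7]
  rw [Finset.prod_const_one, mul_one, Finset.prod_pow_eq_pow_sum,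
    show ∑ i : Fin n, l.rowLen i.rev = ∑ i : Fin n, l.rowLen i from
      Equiv.sum_comp Fin.revPerm (fun p : Fin n => l.rowLen p), card_eq_sum_rowLen l hn,
    Fin.sum_univ_eq_sum_range]

variable {R : Type*} [CommRing R]

/-- Jacobi's theorem on complementary minors of inverse matrices: replacing the first block column
of B by that of the identity makes both B and the product block triangular. -/
theorem det_toBlocks₂₂_of_mul_eq_one {m n : Type*} [Fintype m] [Fintype n] [DecidableEq m]
    [DecidableEq n] {A B : Matrix (m ⊕ n) (m ⊕ n) R} (h : A * B = 1) :
    A.det * B.toBlocks₂₂.det = A.toBlocks₁₁.det := by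
  rw [← Matrix.fromBlocks_toBlocks A, ← Matrix.fromBlocks_toBlocks B,
    Matrix.fromBlocks_multiply, ← Matrix.fromBlocks_one, Matrix.fromBlocks_inj] at h
  have h1 : A * Matrix.fromBlocks 1 B.toBlocks₁₂ 0 B.toBlocks₂₂ =
      Matrix.fromBlocks A.toBlocks₁₁ 0 A.toBlocks₂₁ 1 := by
    conv_lhs => rw [← Matrix.fromBlocks_toBlocks A]
    rw [Matrix.fromBlocks_multiply, h.2.1, h.2.2.2]
    simp
  have h2 := congrArg Matrix.det h1
  rwa [Matrix.det_mul, Matrix.det_fromBlocks_zero₂₁, Matrix.det_fromBlocks_zero₁₂, Matrix.det_one,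
    Matrix.det_one, one_mul, mul_one] at h2

/-- The equivalence `g` is only a reference labelling against which the two signs are measured. -/
theorem det_submatrix_equiv {m n : Type*} [Fintype m] [Fintype n] [DecidableEq m]
    [DecidableEq n] (A : Matrix n n R) (e f g : m ≃ n) :
    (A.submatrix e f).det =
      ((Equiv.Perm.sign (g.symm.trans e) * Equiv.Perm.sign (g.symm.trans f) : ℤˣ) : ℤ) * A.det := by
  have h : A.submatrix e f = (A.submatrix (f.symm.trans e) id).submatrix f f := by
    ext i j
    simp
  have h' : f.symm.trans e = (g.symm.trans f).symm.trans (g.symm.trans e) := by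
    ext i
    simp
  rw [h, Matrix.det_submatrix_equiv_self, Matrix.det_permute, h', Equiv.Perm.sign_trans,
    Equiv.Perm.sign_symm]

/-- The Toeplitz matrix of a power series. -/
def toeplitz (F : PowerSeries R) (M : ℕ) : Matrix (Fin M) (Fin M) R :=
  Matrix.of fun p q => zcoeff F ((p : ℤ) - q)

theorem toeplitz_mul (F G : PowerSeries R) (M : ℕ) :
    toeplitz F M * toeplitz G M = toeplitz (F * G) M := by
  ext p q
  simp only [Matrix.mul_apply, toeplitz, Matrix.of_apply]
  rw [Fin.sum_univ_eq_sum_range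
    (fun r => zcoeff F ((p : ℤ) - (r : ℕ)) * zcoeff G (((r : ℕ) : ℤ) - q)),
    sum_zcoeff_mul_zcoeff _ _ p.2]

theorem toeplitz_one (M : ℕ) : toeplitz (1 : PowerSeries R) M = 1 := by
  ext p q
  rw [toeplitz, Matrix.of_apply, zcoeff_one, Matrix.one_apply]
  congr 1
  rw [Fin.ext_iff, eq_iff_iff]
  omega

theorem det_toeplitz {F : PowerSeries R} (hF : constantCoeff F = 1) (M : ℕ) :
    (toeplitz F M).det = 1 := by
  rw [Matrix.det_of_isLowerTriangular]
  · refine Finset.prod_eq_one fun i _ => ?_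
    rw [toeplitz, Matrix.of_apply, sub_self, zcoeff_zero, hF]
  · intro p q hpq
    exact zcoeff_sub_of_lt _ hpq

/-- The duality `s_{l/m}[h] = s_{l'/m'}[e]`, where `H(t) E(-t) = 1`. -/
theorem jacobiTrudi_transpose {H E : PowerSeries R} (hH : constantCoeff H = 1)
    (hHE : H * evalNegHom E = 1) {l m : YoungDiagram} (hl : l.colLen 0 ≤ n) (hm : m.colLen 0 ≤ n)
    (hl' : l.rowLen 0 ≤ N) (hm' : m.rowLen 0 ≤ N) :
    jacobiTrudi H n l m = jacobiTrudi E N l.transpose m.transpose := by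
  set e := mayaEquiv l hl hl'
  set f := mayaEquiv m hm hm'
  -- Rows follow the Maya diagram of l and columns that of m. The particle corner of A is then the
  -- determinant in h, and the complementary hole corner of its inverse is, up to sign, the
  -- transposed determinant in e.
  set A := (toeplitz H (n + N)).submatrix e f with hA
  set B := (toeplitz (evalNegHom E) (n + N)).submatrix f e with hB
  have hAB : A * B = 1 := by
    rw [hA, hB, Matrix.submatrix_mul_equiv, toeplitz_mul, hHE, toeplitz_one,
      Matrix.submatrix_one_equiv]
  have key := det_toBlocks₂₂_of_mul_eq_one hAB
  have h1 : A.det = (-1) ^ (l.card + m.card) := by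
    rw [hA, det_submatrix_equiv _ e f finSumFinEquiv, det_toeplitz hH, mul_one]
    have hs1 : Equiv.Perm.sign (finSumFinEquiv.symm.trans e) = (-1) ^ l.card :=
      sign_mayaPerm l hl hl'
    have hs2 : Equiv.Perm.sign (finSumFinEquiv.symm.trans f) = (-1) ^ m.card :=
      sign_mayaPerm m hm hm'
    rw [hs1, hs2, pow_add]
    push_cast
    rfl
  have h2 : A.toBlocks₁₁.det = jacobiTrudi H n l m := by
    rw [jacobiTrudi_eq_det_beta, ← Matrix.det_submatrix_equiv_self Fin.revPerm]
    congr 1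
    ext i j
    simp only [Matrix.submatrix_apply, Matrix.toBlocks₁₁, Matrix.of_apply, hA, toeplitz, e, f,
      mayaEquiv_inl, Fin.revPerm_apply, Fin.rev_rev]
  have h3 : B.toBlocks₂₂.det =
      (-1) ^ (l.card + m.card) * jacobiTrudi E N l.transpose m.transpose := by
    -- The sign from X ↦ -X splits into a row and a column factor. Over all rows and columns they
    -- give (-1)^(|l|+|m|) times the square of ∏ (-1)^i.
    have h4 : B.toBlocks₂₂.transpose = Matrix.of fun i j : Fin N =>
        (-1) ^ (l.colLen i + (i : ℕ)) * (Matrix.of fun i j : Fin N =>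
          (-1) ^ (m.colLen j + (j : ℕ)) * Matrix.of (fun i j : Fin N => zcoeff E
            ((l.transpose.rowLen i : ℤ) - (m.transpose.rowLen j : ℤ) - (i : ℤ) + (j : ℤ))) i j)
          i j := by
      ext i j
      simp only [Matrix.transpose_apply, Matrix.toBlocks₂₂, Matrix.of_apply, hB,
        Matrix.submatrix_apply, toeplitz, e, f, mayaEquiv_inr, YoungDiagram.rowLen_transpose]
      have := l.colLen_anti 0 i (Nat.zero_le _)
      have := m.colLen_anti 0 j (Nat.zero_le _)
      rw [show ((n + j - m.colLen j : ℕ) : ℤ) - (n + i - l.colLen i : ℕ) =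
        ((l.colLen i + j : ℕ) : ℤ) - (m.colLen j + i : ℕ) by omega, zcoeff_evalNegHom,
        ← mul_assoc, ← pow_add, show l.colLen i + i + (m.colLen j + j) =
          l.colLen i + j + (m.colLen j + i) by ring]
      congr 2
      push_cast
      ring
    rw [← Matrix.det_transpose, h4, Matrix.det_mul_column, Matrix.det_mul_row, ← mul_assoc,
      jacobiTrudi]
    congr 1
    have h5 : ∀ k : YoungDiagram, k.rowLen 0 ≤ N →
        ∏ i : Fin N, (-1 : R) ^ (k.colLen i + (i : ℕ)) =
          (-1) ^ k.card * ∏ i : Fin N, (-1 : R) ^ (i : ℕ) := by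
      intro k hk
      simp_rw [pow_add]
      rw [Finset.prod_mul_distrib, Finset.prod_pow_eq_pow_sum, ← card_transpose,
        card_eq_sum_rowLen k.transpose (n := N) (by rwa [YoungDiagram.colLen_transpose]),
        ← Fin.sum_univ_eq_sum_range]
      simp_rw [YoungDiagram.rowLen_transpose]
    have h6 : (∏ i : Fin N, (-1 : R) ^ (i : ℕ)) * ∏ i : Fin N, (-1 : R) ^ (i : ℕ) = 1 := by
      rw [← Finset.prod_mul_distrib]
      refine Finset.prod_eq_one fun i _ => ?_
      rw [← pow_add]
      exact Even.neg_one_pow ⟨_, rfl⟩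
    rw [h5 l hl', h5 m hm', pow_add]
    linear_combination ((-1) ^ l.card * (-1) ^ m.card) * h6
  rw [h1, h2, h3, ← mul_assoc, ← pow_add, Even.neg_one_pow ⟨_, rfl⟩, one_mul] at key
  exact key.symm

end Duality

/-! ### Infinite alphabets as limits of finite ones -/

section Alphabets

open PowerSeries Filter Topology

/-- A multiset in the first n letters is recorded by its multiplicities, which are the exponents
chosen in the product of geometric series. -/
theorem sum_sym_range_eq_coeff {A : Type*} [CommRing A] (z : ℕ → A) (n k : ℕ) :
    ∑ s ∈ (Finset.range n).sym k, ((s : Multiset ℕ).map z).prod =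
      coeff k (∏ i ∈ Finset.range n, geom (z i)) := by
  rw [coeff_prod]
  refine Finset.sum_bij' (fun s _ => Multiset.toFinsupp (s : Multiset ℕ))
    (fun f hf => Sym.mk (Finsupp.toMultiset f) (by
      rw [Finset.mem_finsuppAntidiag] at hf
      rw [Finsupp.card_toMultiset, Finsupp.sum_of_support_subset f hf.2 _ (by simp)]
      exact hf.1)) ?_ ?_ ?_ ?_ ?_
  · intro s hs
    rw [Finset.mem_sym_iff] at hs
    have hsub : (s : Multiset ℕ).toFinset ⊆ Finset.range n := fun a ha =>
      hs a (by simpa using ha)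
    rw [Finset.mem_finsuppAntidiag]
    refine ⟨?_, by simpa using hsub⟩
    rw [show ⇑(Multiset.toFinsupp (s : Multiset ℕ)) = fun a => (s : Multiset ℕ).count a from
      funext fun a => Multiset.toFinsupp_apply _ a, ← Finset.sum_subset hsub, Multiset.toFinset_sum_count_eq]
    · exact s.2
    · intro a _ ha
      exact Multiset.count_eq_zero.2 (by simpa using ha)
  · intro f hf
    rw [Finset.mem_finsuppAntidiag] at hf
    refine Finset.mem_sym_iff.2 fun a ha => ?_
    have ha : a ∈ Finsupp.toMultiset f := ha
    exact hf.2 ((Finsupp.mem_toMultiset f a).1 ha)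
  · intro s _
    apply Subtype.ext
    simp
  · intro f _
    simp
  · intro s hs
    rw [Finset.mem_sym_iff] at hs
    have hsub : (s : Multiset ℕ).toFinset ⊆ Finset.range n := fun a ha =>
      hs a (by simpa using ha)
    rw [Finset.prod_multiset_map_count]
    simp only [coeff_geom, Multiset.toFinsupp_apply]
    refine Finset.prod_subset hsub fun a _ ha => ?_
    rw [Multiset.count_eq_zero.2 (by simpa using ha), pow_zero]

theorem tendsto_sym_range (k : ℕ) :
    Tendsto (fun n => (Finset.range n).sym k) atTop atTop := by
  refine tendsto_atTop_finset_of_monotone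
    (fun a b h => Finset.sym_mono (Finset.range_mono h) k) fun s => ?_
  -- The sum of a multiset of naturals bounds each of its elements.
  refine ⟨(s : Multiset ℕ).sum + 1, ?_⟩
  rw [Finset.mem_sym_iff]
  intro a ha
  rw [Finset.mem_range]
  have := Multiset.single_le_sum (s := (s : Multiset ℕ)) (fun _ _ => Nat.zero_le _) a
    (Sym.mem_coe.2 ha)
  omega

variable {A : Type*} [CommRing A] [TopologicalSpace A]

/-- The generating series of the complete homogeneous symmetric functions. -/
def hSeries (z : ℕ → A) : PowerSeries A := mk fun k => completeHomogeneous z k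

@[simp]
theorem zcoeff_hSeries (z : ℕ → A) (k : ℤ) : zcoeff (hSeries z) k = completeHomogeneous z k := by
  by_cases h : k < 0
  · rw [zcoeff_of_neg _ h, completeHomogeneous, if_pos h]
  · obtain ⟨a, rfl⟩ := Int.eq_ofNat_of_zero_le (not_lt.1 h)
    rw [zcoeff_natCast, hSeries, coeff_mk]

theorem constantCoeff_hSeries (z : ℕ → A) : constantCoeff (hSeries z) = 1 := by
  rw [← zcoeff_zero, zcoeff_hSeries, completeHomogeneous, if_neg (lt_irrefl 0)]
  change ∑' s : Sym ℕ 0, _ = _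
  rw [tsum_eq_single default fun s hs => absurd (Subsingleton.elim s default) hs]
  rfl

theorem skewSchur_eq_jacobiTrudi (z : ℕ → A) {l m : YoungDiagram} {n : ℕ} (hl : l.colLen 0 ≤ n)
    (hm : m.colLen 0 ≤ n) : skewSchur z l m = jacobiTrudi (hSeries z) n l m := by
  rw [jacobiTrudi_eq_of_le (constantCoeff_hSeries z) (le_max_left _ _) (le_max_right _ _)
    (max_le hl hm), skewSchur, jacobiTrudi]
  simp_rw [zcoeff_hSeries]

theorem schur_eq_jacobiTrudi (z : ℕ → A) {l : YoungDiagram} {n : ℕ} (hl : l.colLen 0 ≤ n) :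
    schur z l = jacobiTrudi (hSeries z) n l ⊥ :=
  skewSchur_eq_jacobiTrudi z hl (by simp)

theorem skewSchur_eq_zero_of_card_lt (z : ℕ → A) {l m : YoungDiagram} (h : l.card < m.card) :
    skewSchur z l m = 0 := by
  rw [skewSchur_eq_jacobiTrudi z (le_max_left _ _) (le_max_right _ _)]
  exact jacobiTrudi_eq_zero_of_card_lt _ (le_max_left _ _) (le_max_right _ _) h

theorem skewSchur_bot_bot (z : ℕ → A) : skewSchur z ⊥ ⊥ = 1 := by
  rw [skewSchur_eq_jacobiTrudi z (n := 0) (by simp) (by simp),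
    jacobiTrudi_bot_bot (constantCoeff_hSeries z)]

/-- The families that define the complete homogeneous symmetric functions are summable. -/
def HSummable (z : ℕ → A) : Prop :=
  ∀ k : ℕ, Summable fun s : Sym ℕ k => ((s : Multiset ℕ).map z).prod

theorem HSummable.tendsto_coeff_prod_geom {z : ℕ → A} (hz : HSummable z) (k : ℕ) :
    Tendsto (fun n => coeff k (∏ i ∈ Finset.range n, geom (z i))) atTop
      (𝓝 (coeff k (hSeries z))) := by
  have h := (hz k).hasSum.comp (tendsto_sym_range k)
  rw [← zcoeff_natCast (hSeries z), zcoeff_hSeries, completeHomogeneous, if_neg (by omega)]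
  refine h.congr fun n => ?_
  exact sum_sym_range_eq_coeff z n k

theorem tendsto_zcoeff {ι : Type*} {𝓕 : Filter ι} {F : ι → PowerSeries A} {G : PowerSeries A}
    (h : ∀ k, Tendsto (fun i => coeff k (F i)) 𝓕 (𝓝 (coeff k G))) (k : ℤ) :
    Tendsto (fun i => zcoeff (F i) k) 𝓕 (𝓝 (zcoeff G k)) := by
  by_cases hk : k < 0
  · simp_rw [zcoeff_of_neg _ hk]
    exact tendsto_const_nhds
  · obtain ⟨a, rfl⟩ := Int.eq_ofNat_of_zero_le (not_lt.1 hk)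
    simp_rw [zcoeff_natCast]
    exact h a

variable [IsTopologicalRing A]

theorem tendsto_jacobiTrudi {ι : Type*} {𝓕 : Filter ι} {F : ι → PowerSeries A} {G : PowerSeries A}
    (h : ∀ k, Tendsto (fun i => coeff k (F i)) 𝓕 (𝓝 (coeff k G))) (n : ℕ) (l m : YoungDiagram) :
    Tendsto (fun i => jacobiTrudi (F i) n l m) 𝓕 (𝓝 (jacobiTrudi G n l m)) := by
  simp_rw [jacobiTrudi, Matrix.det_apply, Matrix.of_apply]
  refine tendsto_finsetSum _ fun σ _ => ?_
  simp_rw [Units.smul_def, zsmul_eq_mul]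
  exact tendsto_const_nhds.mul (tendsto_finsetProd _ fun i _ => tendsto_zcoeff h _)

theorem tendsto_coeff_mul {ι : Type*} {𝓕 : Filter ι} {F : ι → PowerSeries A} {G : PowerSeries A}
    (h : ∀ k, Tendsto (fun i => coeff k (F i)) 𝓕 (𝓝 (coeff k G))) (P : PowerSeries A) (k : ℕ) :
    Tendsto (fun i => coeff k (F i * P)) 𝓕 (𝓝 (coeff k (G * P))) := by
  simp_rw [coeff_mul]
  exact tendsto_finsetSum _ fun x _ => (h _).mul tendsto_const_nhds

end Alphabets

/-! ### The principal specialization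

Throughout this section `H = ∏ i, 1 / (1 - T ^ (2 i + 1) X)`, characterized by its functional
equation. -/

section Principal

open PowerSeries

variable {K : Type*} [Field K]

/-- `H` satisfies `H (T ^ 2 X) = (1 - T X) H (X)` and `H (0) = 1`. -/
structure IsPrincipal (T : K) (H : PowerSeries K) : Prop where
  constantCoeff : constantCoeff H = 1
  coeff_succ : ∀ k, (1 - T ^ (2 * (k + 1))) * coeff (k + 1) H = T * coeff k H

/-- The series `E` with `H (X) E (-X) = 1`. -/
def dualPrincipal (T : K) (H : PowerSeries K) : PowerSeries K :=
  mk fun k => T ^ (k * (k - 1)) * coeff k H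

variable {T : K} {H : PowerSeries K}

theorem rescale_eq_of_isPrincipal (h : IsPrincipal T H) :
    rescale (T ^ 2) H = (1 - C T * X) * H := by
  ext k
  rw [coeff_rescale, sub_mul, one_mul, map_sub, mul_assoc, coeff_C_mul]
  cases k with
  | zero => simp
  | succ k =>
    rw [coeff_succ_X_mul, ← h.coeff_succ]
    ring

theorem dualPrincipal_eq (h : IsPrincipal T H) :
    dualPrincipal T H = (1 + C T * X) * rescale (T ^ 2) (dualPrincipal T H) := by
  ext k
  rw [add_mul, one_mul, map_add, mul_assoc, coeff_C_mul, coeff_rescale]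
  cases k with
  | zero => simp
  | succ k =>
    rw [coeff_succ_X_mul, coeff_rescale, dualPrincipal, coeff_mk, coeff_mk, Nat.add_sub_cancel]
    have h1 : T ^ ((k + 1) * k) = T ^ (k * (k - 1)) * (T ^ 2) ^ k := by
      rw [← pow_mul, ← pow_add]
      congr 1
      cases k with
      | zero => rfl
      | succ k => rw [Nat.add_sub_cancel]; ring
    linear_combination T ^ ((k + 1) * k) * h.coeff_succ k + T * coeff k H * h1

/-- By the two functional equations D(X) = H(X) E(-X) satisfies D(T²X) = D(X). As T^{2k} ≠ 1 for k ≥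
1, only the constant term of D survives. -/
theorem mul_evalNegHom_dualPrincipal (h : IsPrincipal T H) (hT : ∀ k, T ^ (2 * (k + 1)) ≠ 1) :
    H * evalNegHom (dualPrincipal T H) = 1 := by
  have hneg : evalNegHom (dualPrincipal T H) =
      (1 - C T * X) * rescale (T ^ 2) (evalNegHom (dualPrincipal T H)) := by
    conv_lhs => rw [dualPrincipal_eq h]
    rw [map_mul, evalNegHom, rescale_rescale, rescale_rescale, mul_comm (T ^ 2)]
    congr 1
    have hC : rescale (-1 : K) (C T) = C T := by
      ext k
      rw [coeff_rescale, coeff_C]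
      split_ifs with hk <;> simp [hk]
    rw [map_add, map_one, map_mul, rescale_X, hC, map_neg, map_one]
    ring
  have hD : rescale (T ^ 2) (H * evalNegHom (dualPrincipal T H)) =
      H * evalNegHom (dualPrincipal T H) := by
    conv_rhs => rw [hneg]
    rw [map_mul, rescale_eq_of_isPrincipal h]
    ring
  ext k
  cases k with
  | zero =>
    rw [coeff_zero_eq_constantCoeff_apply, map_mul, h.constantCoeff, one_mul,
      ← coeff_zero_eq_constantCoeff_apply, evalNegHom, coeff_rescale, dualPrincipal, coeff_mk]
    simp [h.constantCoeff]
  | succ k =>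
    have := congrArg (coeff (k + 1)) hD
    rw [coeff_rescale] at this
    have h1 : ((T ^ 2) ^ (k + 1) - 1) *
        coeff (k + 1) (H * evalNegHom (dualPrincipal T H)) = 0 := by
      linear_combination this
    rw [← pow_mul, mul_eq_zero, sub_eq_zero, or_iff_right (hT k)] at h1
    rw [h1, coeff_one, if_neg (Nat.succ_ne_zero k)]

theorem rescale_geom (a w : K) : rescale a (geom w) = geom (a * w) := by
  ext k
  simp [mul_pow]

/-- Insert E(X) = (1 + TX) E(T²X) and T(1 + TX) = T(1 + T^{2a+3}X) + T²(1 - T^{2a+2})X, then divide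
by 1 + T^{2a+3}X and compare coefficients. -/
theorem coeff_dualPrincipal_mul_geom_succ (h : IsPrincipal T H) (a b : ℕ) :
    T * coeff (b + 1) (dualPrincipal T H * geom (-T ^ (2 * (a + 1) + 1))) =
      T ^ (2 * (b + 1)) * (1 - T ^ (2 * (a + 1))) *
        coeff b (dualPrincipal T H * geom (-T ^ (2 * a + 1))) +
      T * T ^ (2 * (b + 1)) * coeff (b + 1) (dualPrincipal T H) := by
  have h1 : C T * (dualPrincipal T H * geom (-T ^ (2 * (a + 1) + 1))) =
      X * (C (T ^ 2 * (1 - T ^ (2 * (a + 1)))) *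
        rescale (T ^ 2) (dualPrincipal T H * geom (-T ^ (2 * a + 1)))) +
      C T * rescale (T ^ 2) (dualPrincipal T H) := by
    have hg := one_sub_mul_geom (-T ^ (2 * (a + 1) + 1))
    conv_lhs => rw [dualPrincipal_eq h]
    rw [map_mul (rescale (T ^ 2)), rescale_geom,
      show T ^ 2 * -T ^ (2 * a + 1) = -T ^ (2 * (a + 1) + 1) by ring]
    simp only [map_mul, map_sub, map_neg, map_one, map_pow] at hg ⊢
    linear_combination (C T * rescale (T ^ 2) (dualPrincipal T H)) * hg
  have h2 := congrArg (coeff (b + 1)) h1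
  rw [coeff_C_mul, map_add, coeff_succ_X_mul, coeff_C_mul, coeff_C_mul, coeff_rescale,
    coeff_rescale] at h2
  rw [h2]
  ring

/-- The evaluation behind the key identity: the dependence on a and b nearly separates, leaving one
geometric factor in a. The proof is by induction on a, for all b at once. -/
theorem sum_zcoeff_mul_eq (h : IsPrincipal T H) (hT : T ≠ 0) {N a b : ℕ} (ha : a < N) :
    T ^ (b * (b + 1)) *
        ∑ k ∈ Finset.range N, zcoeff H ((a : ℤ) - (k : ℕ)) * zcoeff H ((b : ℤ) - (k : ℕ)) =
      coeff a H * coeff b (dualPrincipal T H * geom (-T ^ (2 * a + 1))) := by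
  have h0 : coeff 0 H = 1 := by rw [coeff_zero_eq_constantCoeff_apply, h.constantCoeff]
  induction a generalizing N b with
  | zero =>
    rw [Finset.sum_eq_single 0]
    · have h1 : dualPrincipal T H * geom (-T ^ (2 * 0 + 1)) =
          rescale (T ^ 2) (dualPrincipal T H) := by
        have hg := one_sub_mul_geom (-T ^ (2 * 0 + 1))
        conv_lhs => rw [dualPrincipal_eq h]
        simp only [map_neg, mul_zero, zero_add, pow_one] at hg ⊢
        linear_combination rescale (T ^ 2) (dualPrincipal T H) * hg
      rw [h1, coeff_rescale, dualPrincipal, coeff_mk, zcoeff_sub_of_le _ le_rfl,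
        zcoeff_sub_of_le _ (Nat.zero_le _), Nat.sub_zero, Nat.sub_zero, h0, one_mul, one_mul,
        ← mul_assoc, ← pow_mul, ← pow_add]
      congr 2
      cases b with
      | zero => rfl
      | succ b => rw [Nat.add_sub_cancel]; ring
    · intro k _ hk
      rw [zcoeff_sub_of_lt _ (Nat.pos_of_ne_zero hk), zero_mul]
    · intro h; exact absurd (Finset.mem_range.2 ha) h
  | succ a ih =>
    cases b with
    | zero =>
      rw [Finset.sum_eq_single 0]
      · rw [zcoeff_sub_of_le _ (Nat.zero_le _), zcoeff_sub_of_le _ le_rfl]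
        simp [dualPrincipal, h.constantCoeff, constantCoeff_geom]
      · intro k _ hk
        rw [zcoeff_sub_of_lt (a := 0) _ (Nat.pos_of_ne_zero hk), mul_zero]
      · intro h; exact absurd (Finset.mem_range.2 (by omega)) h
    | succ b =>
      obtain ⟨M, rfl⟩ : ∃ M, N = M + 1 := ⟨N - 1, by omega⟩
      -- Splitting off k = 0 gives S(a+1, b+1) = h_{a+1} h_{b+1} + S(a, b), which matches the
      -- recursion of the right-hand side.
      rw [Finset.sum_range_succ']
      have hs : ∀ c k : ℕ, ((c + 1 : ℕ) : ℤ) - ((k + 1 : ℕ) : ℤ) = (c : ℤ) - (k : ℕ) := by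
        intro c k; push_cast; ring
      simp_rw [hs]
      rw [zcoeff_sub_of_le _ (Nat.zero_le _), zcoeff_sub_of_le _ (Nat.zero_le _), Nat.sub_zero,
        Nat.sub_zero]
      have ih := ih (N := M) (b := b) (by omega)
      have hr := coeff_dualPrincipal_mul_geom_succ h a b
      have he : coeff (b + 1) (dualPrincipal T H) = T ^ (b * (b + 1)) * coeff (b + 1) H := by
        rw [dualPrincipal, coeff_mk, Nat.add_sub_cancel, mul_comm (b + 1)]
      have hpow : T ^ ((b + 1) * (b + 1 + 1)) = T ^ (b * (b + 1)) * T ^ (2 * (b + 1)) := by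
        rw [← pow_add]; congr 1; ring
      apply mul_left_cancel₀ hT
      rw [he] at hr
      rw [hpow]
      linear_combination T * T ^ (2 * (b + 1)) * ih - coeff (a + 1) H * hr -
        T ^ (2 * (b + 1)) * coeff b (dualPrincipal T H * geom (-T ^ (2 * a + 1))) *
          h.coeff_succ a

/-- The letters `T ^ (2 (β_i - n) + 1)`, where `β = l + δ`. -/
def particles (T : K) (n : ℕ) (l : YoungDiagram) (i : Fin n) : K :=
  T ^ (2 * (beta n l i : ℤ) + 1 - 2 * n)

theorem coeff_rescale_mul_geom (hT : T ≠ 0) (E : PowerSeries K) (n a b : ℕ) :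
    coeff b (rescale (T ^ (-(2 * n : ℤ))) E * geom (-T ^ (2 * (a : ℤ) + 1 - 2 * n))) =
      T ^ (-(2 * n * b : ℤ)) * coeff b (E * geom (-T ^ (2 * a + 1))) := by
  have h1 : geom (-T ^ (2 * (a : ℤ) + 1 - 2 * n)) =
      rescale (T ^ (-(2 * n : ℤ))) (geom (-T ^ (2 * a + 1))) := by
    rw [rescale_geom, mul_neg, ← zpow_natCast, ← zpow_add₀ hT]
    congr 3
    push_cast
    ring
  rw [h1, ← map_mul, coeff_rescale, ← zpow_natCast, ← zpow_mul]
  congr 2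
  ring

/-- The sum of products of skew Schur functions over a box, as an alternant times a Schur function
in the complementary alphabet. -/
theorem sum_jacobiTrudi_mul (h : IsPrincipal T H) (hT : T ≠ 0) {n N : ℕ} {l m : YoungDiagram}
    (hN : ∀ i : Fin n, beta n m i < N) :
    ∑ η ∈ boxDiagrams n N, jacobiTrudi H n m η * jacobiTrudi H n l η =
      (∏ i, coeff (beta n m i) H) *
      (∏ j, T ^ ((2 * n * beta n l j : ℤ) - (beta n l j : ℤ) * ((beta n l j : ℤ) + 1))) *
      alternant (fun i => -particles T n m i) ⊥ *
      jacobiTrudi (rescale (T ^ (-(2 * n : ℤ))) (dualPrincipal T H) *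
        ∏ i, geom (-particles T n m i)) n l ⊥ := by
  have h1 := cauchyBinet n N (fun i a => zcoeff H ((beta n m i : ℤ) - a))
    (fun a j => zcoeff H ((beta n l j : ℤ) - a))
  have h2 : ∀ η, Matrix.det (Matrix.of fun i j => zcoeff H ((beta n l j : ℤ) - beta n η i)) =
      jacobiTrudi H n l η := fun η => by
    rw [jacobiTrudi_eq_det_beta, ← Matrix.det_transpose]
    rfl
  -- Each entry is a row factor h_{β_i(m)}, a column factor in T, and a coefficient of the form
  -- treated by `det_coeff_mul_geom`. Rescaling X by T^{-2n} turns T^{2a+1} into the letters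
  -- `particles` and puts 2nb into the exponent.
  have h3 : (Matrix.of fun i j => ∑ a ∈ Finset.range N,
      zcoeff H ((beta n m i : ℤ) - a) * zcoeff H ((beta n l j : ℤ) - a)) =
      Matrix.of fun i j => coeff (beta n m i) H * Matrix.of (fun i j : Fin n =>
        T ^ ((2 * n * beta n l j : ℤ) - (beta n l j : ℤ) * ((beta n l j : ℤ) + 1)) *
        Matrix.of (fun i j : Fin n =>
          coeff (beta n l j) (rescale (T ^ (-(2 * n : ℤ))) (dualPrincipal T H) *
            geom (-particles T n m i))) i j) i j := by
    ext i j
    simp only [Matrix.of_apply, particles]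
    rw [coeff_rescale_mul_geom hT]
    have h4 := sum_zcoeff_mul_eq h hT (b := beta n l j) (hN i)
    rw [← mul_assoc (T ^ _) (T ^ _), ← zpow_add₀ hT, mul_left_comm, ← h4, ← mul_assoc,
      ← zpow_natCast, ← zpow_add₀ hT, eq_comm]
    convert one_mul _
    rw [← zpow_zero T]
    congr 1
    push_cast
    ring
  simp_rw [h2, ← jacobiTrudi_eq_det_beta] at h1
  rw [h1, h3, Matrix.det_mul_column, Matrix.det_mul_row, det_coeff_mul_geom]
  ring

/-- With β_j = l_j + d and d = n - 1 - j, the change in 2nβ - β(β+1) caused by l_j is l_j(2j + 1 -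
l_j), the negative of the j-th term of κ. -/
theorem sum_exponents_eq_kappa {n : ℕ} {l : YoungDiagram} (hl : l.colLen 0 ≤ n) :
    ∑ j, ((2 * n * beta n l j : ℤ) - (beta n l j : ℤ) * ((beta n l j : ℤ) + 1)) =
      -kappa l + ∑ j, ((2 * n * beta n ⊥ j : ℤ) - (beta n ⊥ j : ℤ) * ((beta n ⊥ j : ℤ) + 1)) := by
  rw [kappa_eq_sum_range l hl, ← Fin.sum_univ_eq_sum_range
    (fun i => (l.rowLen i : ℤ) * ((l.rowLen i : ℤ) - 2 * ((i : ℤ) + 1) + 1)),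
    ← Finset.sum_neg_distrib, ← Finset.sum_add_distrib]
  refine Finset.sum_congr rfl fun j _ => ?_
  have := j.2
  obtain ⟨d, hd⟩ : ∃ d : ℕ, n = d + 1 + j := ⟨n - 1 - j, by omega⟩
  have h1 : n - 1 - (j : ℕ) = d := by omega
  simp only [beta, rowLen_bot, h1]
  have hd' : (n : ℤ) = d + 1 + j := by omega
  push_cast
  rw [hd']
  ring

/-- Product of a Schur function at `q^ρ` and a Schur function in the alphabet attached to `m`. -/
theorem sum_jacobiTrudi_mul_eq_kappa (h : IsPrincipal T H) (hT : T ≠ 0) {n N : ℕ}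
    {l m : YoungDiagram} (hl : l.colLen 0 ≤ n) (hN : ∀ i : Fin n, beta n m i < N) :
    ∑ η ∈ boxDiagrams n N, jacobiTrudi H n m η * jacobiTrudi H n l η =
      T ^ (-kappa l) * jacobiTrudi H n m ⊥ *
      jacobiTrudi (rescale (T ^ (-(2 * n : ℤ))) (dualPrincipal T H) *
        ∏ i, geom (-particles T n m i)) n l ⊥ := by
  have hcc : constantCoeff (rescale (T ^ (-(2 * n : ℤ))) (dualPrincipal T H) *
      ∏ i, geom (-particles T n m i)) = 1 := by
    rw [map_mul, constantCoeff_prod_geom, mul_one, ← coeff_zero_eq_constantCoeff_apply,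
      coeff_rescale, dualPrincipal, coeff_mk]
    simp [h.constantCoeff]
  -- For l = ∅ only η = ∅ contributes and the sum is s_m(q^ρ). This evaluates the prefactors without
  -- computing the alternant.
  have h1 := sum_jacobiTrudi_mul h hT (l := ⊥) hN
  rw [jacobiTrudi_bot_bot hcc, mul_one, Finset.sum_eq_single ⊥,
    jacobiTrudi_bot_bot h.constantCoeff, mul_one] at h1
  · rw [sum_jacobiTrudi_mul h hT hN, h1]
    have h2 : ∀ k : YoungDiagram, ∏ j : Fin n,
        T ^ ((2 * n * beta n k j : ℤ) - (beta n k j : ℤ) * ((beta n k j : ℤ) + 1)) =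
        T ^ (∑ j : Fin n,
          ((2 * n * beta n k j : ℤ) - (beta n k j : ℤ) * ((beta n k j : ℤ) + 1))) := by
      intro k
      induction (Finset.univ : Finset (Fin n)) using Finset.induction_on with
      | empty => simp
      | insert a s ha ih => rw [Finset.prod_insert ha, Finset.sum_insert ha, zpow_add₀ hT, ih]
    rw [h2, h2, sum_exponents_eq_kappa hl, zpow_add₀ hT]
    ring
  · intro η hη hne
    rw [mem_boxDiagrams] at hη
    rw [jacobiTrudi_eq_zero_of_card_lt H (l := ⊥) (by simp) hη.1, mul_zero]
    by_contra hcon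
    exact hne (eq_bot_of_card_le_zero (not_lt.1 hcon))
  · intro hcon
    refine absurd (mem_boxDiagrams.2 ⟨by simp, fun i => lt_of_le_of_lt ?_ (hN i)⟩) hcon
    simp [beta]

end Principal

/-! ### The alphabets `q^{l + ρ}` -/

section CoeffTopology

open PowerSeries Filter Topology

instance nonarchimedeanRing_coeff : NonarchimedeanRing Coeff :=
  (Valued.v (R := Coeff)).subgroups_basis.nonarchimedean

theorem tendsto_single_cofinite {ι : Type*} {e : ι → ℤ} (h : ∀ B, {i | e i ≤ B}.Finite) :
    Tendsto (fun i => (HahnSeries.single (e i) (1 : ℚ) : Coeff)) cofinite (𝓝 0) := by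
  rw [(Valued.hasBasis_nhds_zero Coeff _).tendsto_right_iff]
  rintro γ -
  set g := MonoidWithZeroHom.ValueGroup₀.embedding (γ : MonoidWithZeroHom.ValueGroup₀
    (MonoidWithZeroHom.ofClass (Valued.v (R := Coeff)))) with hg
  have hg0 : g ≠ 0 := by
    rw [hg]
    exact (map_ne_zero _).2 γ.ne_zero
  -- The valuation of `single e 1` is exp(-e), so it drops below γ as soon as e exceeds minus the
  -- logarithm of γ.
  refine (h (-WithZero.log g)).subset fun i hi => ?_
  by_contra hcon
  apply hi
  rw [Set.mem_ofPred_eq, not_le] at hcon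
  refine (Valuation.restrict_lt_iff_lt_embedding _).2 ?_
  rw [LaurentSeries.valuation_single_zpow, ← hg, ← WithZero.lt_log_iff_exp_lt hg0]
  omega

theorem summable_single {ι : Type*} {e : ι → ℤ} (h : ∀ B, {i | e i ≤ B}.Finite) :
    Summable fun i => (HahnSeries.single (e i) (1 : ℚ) : Coeff) :=
  NonarchimedeanAddGroup.summable_of_tendsto_cofinite_zero (tendsto_single_cofinite h)

/-- The element `q^{-1/2}`. -/
def qInv : Coeff := HahnSeries.single (1 : ℤ) (1 : ℚ)

theorem qInv_zpow (n : ℤ) : qInv ^ n = HahnSeries.single n (1 : ℚ) :=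
  (RatFunc.single_zpow n).symm

theorem qInv_ne_zero : qInv ≠ 0 := by simp [qInv]

theorem qHalf_eq : qHalf = qInv⁻¹ := by
  rw [← zpow_neg_one, qInv_zpow, qHalf]

theorem qHalf_zpow (n : ℤ) : qHalf ^ n = qInv ^ (-n) := by
  rw [qHalf_eq, inv_zpow']

theorem qInv_zpow_eq_one_iff {n : ℤ} : qInv ^ n = 1 ↔ n = 0 := by
  rw [qInv_zpow]
  constructor
  · intro h
    have h1 := congrArg (fun f : HahnSeries ℤ ℚ => f.coeff n) h
    by_contra hn
    simp [hn] at h1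
  · rintro rfl; rfl

theorem qRho_eq (l : YoungDiagram) (i : ℕ) :
    qRho l i = qInv ^ (2 * (i : ℤ) + 1 - 2 * (l.rowLen i : ℤ)) := by
  rw [qRho, qHalf_zpow]
  congr 1
  ring

theorem prod_map_qRho (l : YoungDiagram) (s : Multiset ℕ) :
    (s.map (qRho l)).prod =
      qInv ^ (s.map fun i : ℕ => 2 * (i : ℤ) + 1 - 2 * (l.rowLen i : ℤ)).sum := by
  induction s using Multiset.induction_on with
  | empty => simp
  | cons a s ih =>
    rw [Multiset.map_cons, Multiset.prod_cons, ih, Multiset.map_cons, Multiset.sum_cons,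
      zpow_add₀ qInv_ne_zero, qRho_eq]

/-- Letters of q^{l+ρ} may carry negative powers of q^{-1/2}, but no worse than -2 l_0 each. In
fixed degree a bounded exponent therefore bounds every index, which yields summability. -/
theorem le_sum_map_exponents (l : YoungDiagram) (s : Multiset ℕ) {a : ℕ} (ha : a ∈ s) :
    (a : ℤ) - 2 * l.rowLen 0 * s.card ≤
      (s.map fun i : ℕ => 2 * (i : ℤ) + 1 - 2 * (l.rowLen i : ℤ)).sum := by
  have hb : ∀ t : Multiset ℕ, -(2 * l.rowLen 0 * t.card : ℤ) ≤
      (t.map fun i : ℕ => 2 * (i : ℤ) + 1 - 2 * (l.rowLen i : ℤ)).sum := by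
    intro t
    induction t using Multiset.induction_on with
    | empty => simp
    | cons b t ih =>
      rw [Multiset.map_cons, Multiset.sum_cons, Multiset.card_cons]
      have := l.rowLen_anti 0 b (Nat.zero_le _)
      push_cast
      linarith
  obtain ⟨t, rfl⟩ := Multiset.exists_cons_of_mem ha
  have := hb t
  rw [Multiset.map_cons, Multiset.sum_cons, Multiset.card_cons]
  have := l.rowLen_anti 0 a (Nat.zero_le _)
  push_cast
  linarith

theorem hSummable_qRho (l : YoungDiagram) : HSummable (qRho l) := by
  intro k
  simp_rw [prod_map_qRho, qInv_zpow]
  refine summable_single fun B => ?_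
  refine (Finset.finite_toSet ((Finset.range (B + 2 * l.rowLen 0 * k + 1).toNat).sym k)).subset
    fun s hs => ?_
  refine Finset.mem_coe.2 (Finset.mem_sym_iff.2 fun a ha => ?_)
  have h1 := le_sum_map_exponents l (s : Multiset ℕ) (Sym.mem_coe.2 ha)
  have h2 : Multiset.card (s : Multiset ℕ) = k := s.2
  rw [h2] at h1
  rw [Set.mem_ofPred_eq] at hs
  rw [Finset.mem_range]
  omega

theorem summable_qRho_bot_pow {r : ℕ} (hr : r ≠ 0) : Summable fun i => qRho ⊥ i ^ r := by
  have h : ∀ i, qRho ⊥ i ^ r = HahnSeries.single ((2 * (i : ℤ) + 1) * r) (1 : ℚ) := fun i => by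
    rw [qRho_eq, rowLen_bot, ← zpow_natCast, ← zpow_mul, qInv_zpow]
    simp
  simp_rw [h]
  refine summable_single fun B => (Finset.finite_toSet (Finset.range (B + 1).toNat)).subset
    fun i hi => ?_
  rw [Set.mem_ofPred_eq] at hi
  rw [Finset.mem_coe, Finset.mem_range]
  have : (1 : ℤ) ≤ r := by omega
  have : (2 * (i : ℤ) + 1) ≤ (2 * (i : ℤ) + 1) * r := by nlinarith
  omega

/-- A geometric series: splitting off its first letter gives p_r = T^r + T^{2r} p_r. -/
theorem powerSum_qRho_bot {r : ℕ} (hr : r ≠ 0) : powerSum (qRho ⊥) r = (qInt r)⁻¹ := by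
  have hs := summable_qRho_bot_pow hr
  have h1 : powerSum (qRho ⊥) r = qInv ^ r + qInv ^ (2 * r) * powerSum (qRho ⊥) r := by
    conv_lhs => rw [powerSum, hs.tsum_eq_zero_add]
    rw [powerSum, ← tsum_mul_left]
    congr 1
    · rw [qRho_eq]; simp
    · congr 1
      funext i
      rw [qRho_eq, qRho_eq, rowLen_bot, rowLen_bot, ← zpow_natCast, ← zpow_natCast,
        ← zpow_natCast, ← zpow_mul, ← zpow_mul, ← zpow_add₀ qInv_ne_zero]
      congr 1
      push_cast
      ring
  refine eq_inv_of_mul_eq_one_left ?_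
  rw [qInt, qHalf_zpow, qHalf_zpow, neg_neg, zpow_neg, zpow_natCast]
  have hne : qInv ^ r ≠ 0 := pow_ne_zero _ qInv_ne_zero
  field_simp
  rw [pow_mul'] at h1
  linear_combination h1

theorem rescale_prod_geom {K ι : Type*} [Field K] (a : K) (s : Finset ι) (w : ι → K) :
    rescale a (∏ i ∈ s, geom (w i)) = ∏ i ∈ s, geom (a * w i) := by
  rw [map_prod]
  exact Finset.prod_congr rfl fun i _ => rescale_geom a (w i)

/-- Deleting the first letter of q^ρ has the same effect as multiplying all letters by T². This is
exact for truncated products, and the coefficients pass to the limit. -/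
theorem isPrincipal_hSeries_qRho_bot : IsPrincipal qInv (hSeries (qRho ⊥)) where
  constantCoeff := constantCoeff_hSeries _
  coeff_succ k := by
    have hlim := (hSummable_qRho ⊥).tendsto_coeff_prod_geom
    have h1 : ∀ n, (∏ i ∈ Finset.range (n + 1), geom (qRho ⊥ i)) * (1 - C qInv * X) =
        rescale (qInv ^ 2) (∏ i ∈ Finset.range n, geom (qRho ⊥ i)) := by
      intro n
      rw [Finset.prod_range_succ', rescale_prod_geom]
      have h2 : ∀ i, qInv ^ 2 * qRho ⊥ i = qRho ⊥ (i + 1) := fun i => by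
        rw [qRho_eq, qRho_eq, rowLen_bot, rowLen_bot, ← zpow_natCast, ← zpow_add₀ qInv_ne_zero]
        congr 1
        push_cast
        ring
      have h3 : qRho ⊥ 0 = qInv := by rw [qRho_eq]; simp
      simp_rw [h2]
      rw [h3]
      linear_combination
        (∏ i ∈ Finset.range n, geom (qRho ⊥ (i + 1))) * one_sub_mul_geom qInv
    have h4 := tendsto_coeff_mul (fun k => (hlim k).comp (tendsto_add_atTop_nat 1))
      (1 - C qInv * X) (k + 1)
    have h5 : Tendsto (fun n => coeff (k + 1)
        (rescale (qInv ^ 2) (∏ i ∈ Finset.range n, geom (qRho ⊥ i)))) atTop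
        (𝓝 ((qInv ^ 2) ^ (k + 1) * coeff (k + 1) (hSeries (qRho ⊥)))) := by
      simp_rw [coeff_rescale]
      exact tendsto_const_nhds.mul (hlim (k + 1))
    have h6 := tendsto_nhds_unique h4 (h5.congr fun n => by rw [← h1 n])
    rw [mul_comm, sub_mul, one_mul, map_sub, mul_assoc, coeff_C_mul, coeff_succ_X_mul,
      ← pow_mul] at h6
    linear_combination h6

theorem qInv_pow_ne_one (k : ℕ) : qInv ^ (2 * (k + 1)) ≠ 1 := by
  rw [← zpow_natCast, Ne, qInv_zpow_eq_one_iff]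
  omega

/-- The Maya diagram of m splits the exponents 2i + 1 - 2n, i ≥ 0: its particles give `particles`,
its holes the letters of q^{m^t+ρ}. Beyond the diagram every position is a hole, so truncated
products agree and the limit follows. -/
theorem hSeries_qRho_transpose {n : ℕ} {m : YoungDiagram} (hm : m.colLen 0 ≤ n) :
    (∏ i, geom (particles qInv n m i)) * hSeries (qRho m.transpose) =
      rescale (qInv ^ (-(2 * n : ℤ))) (hSeries (qRho ⊥)) := by
  have hfin : ∀ N, m.rowLen 0 ≤ N →
      (∏ j ∈ Finset.range N, geom (qRho m.transpose j)) * ∏ i, geom (particles qInv n m i) =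
      rescale (qInv ^ (-(2 * n : ℤ))) (∏ i ∈ Finset.range (N + n), geom (qRho ⊥ i)) := by
    intro N hN
    have h1 : ∀ i : ℕ, qInv ^ (-(2 * n : ℤ)) * qRho ⊥ i = qInv ^ (2 * (i : ℤ) + 1 - 2 * n) := by
      intro i
      rw [qRho_eq, rowLen_bot, ← zpow_add₀ qInv_ne_zero]
      congr 1
      push_cast
      ring
    rw [rescale_prod_geom]
    simp_rw [h1]
    rw [add_comm N n, ← Fin.prod_univ_eq_prod_range
      (fun i : ℕ => geom (qInv ^ (2 * (i : ℤ) + 1 - 2 * (n : ℤ)))) (n + N),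
      ← Equiv.prod_comp (mayaEquiv m hm hN), Fintype.prod_sum_type, mul_comm]
    congr 1
    · simp only [mayaEquiv_inl, particles]
      exact (Equiv.prod_comp Fin.revPerm (fun i : Fin n =>
        geom (qInv ^ (2 * (beta n m i : ℤ) + 1 - 2 * (n : ℤ))))).symm
    · rw [← Fin.prod_univ_eq_prod_range (fun j => geom (qRho m.transpose j)) N]
      refine Finset.prod_congr rfl fun j _ => ?_
      rw [mayaEquiv_inr, qRho_eq, YoungDiagram.rowLen_transpose]
      have := m.colLen_anti 0 j (Nat.zero_le _)
      congr 2
      omega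
  rw [mul_comm]
  refine PowerSeries.ext fun k => ?_
  have h2 := tendsto_coeff_mul (hSummable_qRho m.transpose).tendsto_coeff_prod_geom
    (∏ i, geom (particles qInv n m i)) k
  have h3 : Tendsto (fun N => coeff k (rescale (qInv ^ (-(2 * n : ℤ)))
      (∏ i ∈ Finset.range (N + n), geom (qRho ⊥ i)))) atTop
      (𝓝 (coeff k (rescale (qInv ^ (-(2 * n : ℤ))) (hSeries (qRho ⊥))))) := by
    simp_rw [coeff_rescale]
    exact tendsto_const_nhds.mul
      (((hSummable_qRho ⊥).tendsto_coeff_prod_geom k).comp (tendsto_add_atTop_nat n))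
  refine tendsto_nhds_unique h2 (h3.congr' ?_)
  filter_upwards [eventually_ge_atTop (m.rowLen 0)] with N hN
  rw [hfin N hN]

theorem framedVertex_eq_mul (l m : YoungDiagram) :
    framedVertex (-1) 0 0 l m ⊥ =
      qInv ^ kappa l * schur (qRho ⊥) m * schur (qRho m.transpose) l := by
  have hk : kappa ⊥ = 0 := by simp [kappa]
  rw [framedVertex, vertex, finsum_eq_single _ ⊥]
  · rw [transpose_bot, skewSchur_bot_bot, qHalf_zpow, hk, zpow_zero, schur]
    simp only [neg_one_mul, zero_mul, add_zero, neg_neg, one_mul, mul_one, schur]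
    ring
  · intro η hη
    rw [transpose_bot, skewSchur_eq_zero_of_card_lt (qRho m) (l := ⊥), mul_zero]
    by_contra hcon
    exact hη (eq_bot_of_card_le_zero (not_lt.1 hcon))

/-- The two-leg vertex as a sum of products of skew Schur functions. -/
theorem framedVertex_eq_sum {n N : ℕ} {l m : YoungDiagram} (hl : l.rowLen 0 ≤ n)
    (hm : m.colLen 0 ≤ n) (hN : ∀ i : Fin n, beta n m i < N) :
    framedVertex (-1) 0 0 l m ⊥ = ∑ η ∈ boxDiagrams n N,
      skewSchur (qRho ⊥) m η * skewSchur (qRho ⊥) l.transpose η := by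
  have hP := isPrincipal_hSeries_qRho_bot
  have hl' : l.transpose.colLen 0 ≤ n := by rwa [YoungDiagram.colLen_transpose]
  have h1 : ∑ η ∈ boxDiagrams n N, skewSchur (qRho ⊥) m η * skewSchur (qRho ⊥) l.transpose η =
      ∑ η ∈ boxDiagrams n N, jacobiTrudi (hSeries (qRho ⊥)) n m η *
        jacobiTrudi (hSeries (qRho ⊥)) n l.transpose η := by
    refine Finset.sum_congr rfl fun η hη => ?_
    rw [mem_boxDiagrams] at hη
    rw [skewSchur_eq_jacobiTrudi _ hm hη.1, skewSchur_eq_jacobiTrudi _ hl' hη.1]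
  rw [h1, sum_jacobiTrudi_mul_eq_kappa hP qInv_ne_zero hl' hN, framedVertex_eq_mul,
    schur_eq_jacobiTrudi (qRho ⊥) hm, schur_eq_jacobiTrudi (qRho m.transpose) le_rfl,
    kappa_transpose, neg_neg]
  congr 1
  rw [jacobiTrudi_transpose (N := n) (constantCoeff_hSeries _) _ le_rfl (by simp) hl (by simp),
    transpose_bot]
  -- Duality requires the series of q^{m^t+ρ} to be inverse to the one at hand after X ↦ -X.
  -- Multiplied by the particle factors, it is the rescaled H(q^ρ), whose inverse is the rescaled
  -- E(-X).
  have h2 := mul_evalNegHom_dualPrincipal hP qInv_pow_ne_one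
  have h3 := congrArg (rescale (qInv ^ (-(2 * n : ℤ)))) h2
  rw [map_mul, map_one, ← hSeries_qRho_transpose hm, evalNegHom, rescale_rescale] at h3
  rw [map_mul, evalNegHom, rescale_rescale, rescale_prod_geom]
  simp only [neg_one_mul, neg_neg]
  rw [mul_comm (-1 : Coeff)] at h3
  linear_combination h3

end CoeffTopology

/-! ### Homogeneity -/

section Homogeneity

open MvPowerSeries Filter Topology

variable {σ R : Type*} [CommRing R] {w : σ → ℕ}

/-- All monomials of `f` have weight `p`. -/
structure IsHomog (w : σ → ℕ) (f : MvPowerSeries σ R) (p : ℕ) : Prop where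
  coeff_eq_zero : ∀ d, Finsupp.weight w d ≠ p → coeff d f = 0

theorem isHomog_zero (p : ℕ) : IsHomog w (0 : MvPowerSeries σ R) p := ⟨fun _ _ => rfl⟩

theorem isHomog_C (r : R) : IsHomog w (C r : MvPowerSeries σ R) 0 := by
  classical
  refine ⟨fun d hd => ?_⟩
  rw [coeff_C, if_neg]
  rintro rfl
  exact hd (map_zero _)

theorem isHomog_one : IsHomog w (1 : MvPowerSeries σ R) 0 := by
  simpa using isHomog_C (w := w) (1 : R)

theorem isHomog_X (i : σ) : IsHomog w (X i : MvPowerSeries σ R) (w i) := by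
  classical
  refine ⟨fun d hd => ?_⟩
  rw [coeff_X, if_neg]
  rintro rfl
  rw [Finsupp.weight_single] at hd
  simp at hd

theorem IsHomog.add {f g : MvPowerSeries σ R} {p : ℕ} (hf : IsHomog w f p)
    (hg : IsHomog w g p) : IsHomog w (f + g) p :=
  ⟨fun d hd => by rw [map_add, hf.coeff_eq_zero d hd, hg.coeff_eq_zero d hd, add_zero]⟩

theorem IsHomog.mul {f g : MvPowerSeries σ R} {p q : ℕ} (hf : IsHomog w f p)
    (hg : IsHomog w g q) : IsHomog w (f * g) (p + q) := by
  classical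
  refine ⟨fun d hd => ?_⟩
  rw [coeff_mul]
  refine Finset.sum_eq_zero fun x hx => ?_
  by_cases hp : Finsupp.weight w x.1 = p
  · rw [hg.coeff_eq_zero, mul_zero]
    rintro rfl
    rw [← hp, ← map_add, Finset.HasAntidiagonal.mem_antidiagonal.1 hx] at hd
    exact hd rfl
  · rw [hf.coeff_eq_zero _ hp, zero_mul]

theorem isHomog_sum {ι : Type*} (s : Finset ι) {f : ι → MvPowerSeries σ R} {p : ℕ}
    (h : ∀ i ∈ s, IsHomog w (f i) p) : IsHomog w (∑ i ∈ s, f i) p := by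
  classical
  induction s using Finset.induction_on with
  | empty => exact isHomog_zero p
  | insert a s ha ih =>
    rw [Finset.sum_insert ha]
    exact (h a (Finset.mem_insert_self a s)).add
      (ih fun i hi => h i (Finset.mem_insert_of_mem hi))

theorem isHomog_prod {ι : Type*} (s : Finset ι) {f : ι → MvPowerSeries σ R}
    {p : ι → ℕ} (h : ∀ i ∈ s, IsHomog w (f i) (p i)) :
    IsHomog w (∏ i ∈ s, f i) (∑ i ∈ s, p i) := by
  classical
  induction s using Finset.induction_on with
  | empty => exact isHomog_one
  | insert a s ha ih =>
    rw [Finset.prod_insert ha, Finset.sum_insert ha]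
    exact (h a (Finset.mem_insert_self a s)).mul
      (ih fun i hi => h i (Finset.mem_insert_of_mem hi))

theorem IsHomog.pow {f : MvPowerSeries σ R} {p : ℕ}
    (h : IsHomog w f p) (n : ℕ) : IsHomog w (f ^ n) (n * p) := by
  have := isHomog_prod (Finset.range n) (fun _ _ => h)
  simpa using this

theorem IsHomog.smul {f : MvPowerSeries σ R} {p : ℕ} (h : IsHomog w f p) (r : R) :
    IsHomog w (r • f) p :=
  ⟨fun d hd => by rw [coeff_smul, h.coeff_eq_zero d hd, mul_zero]⟩

theorem isHomog_of_tendsto [TopologicalSpace R] [T2Space R] {ι : Type*}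
    {𝓕 : Filter ι} [𝓕.NeBot] {f : ι → MvPowerSeries σ R} {g : MvPowerSeries σ R} {p : ℕ}
    (h : Tendsto f 𝓕 (𝓝 g)) (hf : ∀ i, IsHomog w (f i) p) : IsHomog w g p := by
  refine ⟨fun d hd => ?_⟩
  have h1 := (WithPiTopology.tendsto_iff_coeff_tendsto _ _ _).1 h d
  have h2 : ∀ i, coeff d (f i) = 0 := fun i => (hf i).coeff_eq_zero d hd
  simp_rw [h2] at h1
  exact (tendsto_nhds_unique h1 tendsto_const_nhds)

/-- Every nonzero Leibniz term has weight a · ∑ (β_l(τ i) - β_∅(i)) = a |l|. Keeping a general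
covers letters of weight 0 and of weight 1. -/
theorem isHomog_jacobiTrudi {F : PowerSeries (MvPowerSeries σ R)} {a : ℕ}
    (hF : ∀ k, IsHomog w (PowerSeries.coeff k F) (a * k)) {n : ℕ}
    {l : YoungDiagram} (hl : l.colLen 0 ≤ n) :
    IsHomog w (jacobiTrudi F n l ⊥) (a * l.card) := by
  rw [jacobiTrudi_eq_det_beta, Matrix.det_apply]
  refine isHomog_sum _ fun τ _ => ?_
  rw [Units.smul_def, zsmul_eq_mul, ← map_intCast (C (σ := σ) (R := R)), ← smul_eq_C_mul]
  refine IsHomog.smul ?_ _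
  by_cases h : ∃ i, beta n l (τ i) < beta n ⊥ i
  · obtain ⟨i, hi⟩ := h
    rw [Finset.prod_eq_zero (Finset.mem_univ i) (zcoeff_sub_of_lt _ hi)]
    exact isHomog_zero _
  · push Not at h
    have h1 : ∑ i, (beta n l (τ i) - beta n ⊥ i) = l.card := by
      have h2 : ∑ i, (beta n l (τ i) - beta n ⊥ i) + ∑ i, beta n ⊥ i = ∑ i, beta n l (τ i) := by
        rw [← Finset.sum_add_distrib]
        exact Finset.sum_congr rfl fun i _ => Nat.sub_add_cancel (h i)
      rw [Equiv.sum_comp τ (beta n l)] at h2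
      have h3 : ∑ i, beta n l i = l.card + ∑ i, beta n ⊥ i := by
        simp only [beta, rowLen_bot, zero_add, Finset.sum_add_distrib]
        rw [card_eq_sum_rowLen l hl, ← Fin.sum_univ_eq_sum_range]
      omega
    rw [← h1, Finset.mul_sum]
    refine isHomog_prod _ fun i _ => ?_
    rw [Matrix.of_apply, zcoeff_sub_of_le _ (h i)]
    exact hF _

theorem isHomog_jacobiTrudi_zero {F : PowerSeries (MvPowerSeries σ R)}
    (hF : ∀ k, IsHomog w (PowerSeries.coeff k F) 0) (n : ℕ) (l m : YoungDiagram) :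
    IsHomog w (jacobiTrudi F n l m) 0 := by
  rw [jacobiTrudi_eq_det_beta, Matrix.det_apply]
  refine isHomog_sum _ fun τ _ => ?_
  rw [Units.smul_def, zsmul_eq_mul, ← map_intCast (C (σ := σ) (R := R)), ← smul_eq_C_mul]
  refine IsHomog.smul ?_ _
  have h := isHomog_prod (Finset.univ : Finset (Fin n)) (p := fun _ => 0) (w := w)
    (f := fun i => zcoeff F ((beta n l (τ i) : ℤ) - beta n m i)) fun i _ => by
      by_cases h : beta n l (τ i) < beta n m i
      · rw [zcoeff_sub_of_lt _ h]; exact isHomog_zero _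
      · rw [zcoeff_sub_of_le _ (not_lt.1 h)]; exact hF _
  simpa using h

theorem isHomog_coeff_mul {F G : PowerSeries (MvPowerSeries σ R)} {a : ℕ}
    (hF : ∀ k, IsHomog w (PowerSeries.coeff k F) (a * k))
    (hG : ∀ k, IsHomog w (PowerSeries.coeff k G) (a * k)) (k : ℕ) :
    IsHomog w (PowerSeries.coeff k (F * G)) (a * k) := by
  rw [PowerSeries.coeff_mul]
  refine isHomog_sum _ fun x hx => ?_
  rw [← Finset.HasAntidiagonal.mem_antidiagonal.1 hx, mul_add]
  exact (hF _).mul (hG _)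

theorem isHomog_coeff_prod {ι : Type*} (s : Finset ι)
    {F : ι → PowerSeries (MvPowerSeries σ R)} {a : ℕ}
    (hF : ∀ i k, IsHomog w (PowerSeries.coeff k (F i)) (a * k)) (k : ℕ) :
    IsHomog w (PowerSeries.coeff k (∏ i ∈ s, F i)) (a * k) := by
  classical
  induction s using Finset.induction_on generalizing k with
  | empty =>
    rw [Finset.prod_empty, PowerSeries.coeff_one]
    split_ifs with h
    · rw [h]; exact isHomog_one
    · exact isHomog_zero _
  | insert i s hi ih =>
    rw [Finset.prod_insert hi]
    exact isHomog_coeff_mul (hF i) ih k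

theorem isHomog_coeff_geom {z : MvPowerSeries σ R} {a : ℕ}
    (h : IsHomog w z a) (k : ℕ) :
    IsHomog w (PowerSeries.coeff k (geom z)) (a * k) := by
  rw [coeff_geom, mul_comm]
  exact h.pow k

theorem isHomog_coeff_one_add {z : MvPowerSeries σ R} {a : ℕ}
    (h : IsHomog w z a) (k : ℕ) :
    IsHomog w
      (PowerSeries.coeff k (1 + PowerSeries.C z * PowerSeries.X)) (a * k) := by
  rw [map_add, PowerSeries.coeff_one, PowerSeries.coeff_C_mul, PowerSeries.coeff_X]
  rcases k with _ | _ | k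
  · simpa using isHomog_one
  · simpa using h
  · simpa using isHomog_zero _

variable [TopologicalSpace R] [T2Space R]

theorem isHomog_schur {z : ℕ → MvPowerSeries σ R} (hz : HSummable z) {a : ℕ}
    (h : ∀ i, IsHomog w (z i) a) (l : YoungDiagram) :
    IsHomog w (schur z l) (a * l.card) := by
  rw [schur_eq_jacobiTrudi z le_rfl]
  refine isHomog_jacobiTrudi (fun k => ?_) le_rfl
  exact isHomog_of_tendsto (hz.tendsto_coeff_prod_geom k) fun n =>
    isHomog_coeff_prod _ (fun i => isHomog_coeff_geom (h i)) k

end Homogeneity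

/-! ### Alphabets of variables -/

section Variables

open MvPowerSeries Filter Topology

variable {σ R : Type*} [CommRing R] [TopologicalSpace R]

theorem summable_of_finite_coeff_ne_zero {ι : Type*} {f : ι → MvPowerSeries σ R}
    (h : ∀ d, {i | coeff d (f i) ≠ 0}.Finite) : Summable f :=
  WithPiTopology.summable_iff_summable_coeff.2 fun d => summable_of_hasFiniteSupport (h d)

/-- Each monomial comes from at most one multiset of letters. -/
theorem hSummable_X {f : ℕ → σ} (hf : Function.Injective f) :
    HSummable fun i => (X (f i) : MvPowerSeries σ R) := by
  classical
  intro k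
  have hmon : ∀ s : Multiset ℕ, (s.map fun i => (X (f i) : MvPowerSeries σ R)).prod =
      monomial (Multiset.toFinsupp (s.map f)) 1 := by
    intro s
    induction s using Multiset.induction_on with
    | empty => simp
    | cons a s ih =>
      rw [Multiset.map_cons, Multiset.prod_cons, ih, Multiset.map_cons, X, monomial_mul_monomial,
        one_mul, ← Multiset.singleton_add, map_add, Multiset.toFinsupp_singleton]
  refine summable_of_finite_coeff_ne_zero fun d => Set.Subsingleton.finite ?_
  have key : ∀ s : Sym ℕ k, coeff d (((s : Multiset ℕ).map fun i =>
      (X (f i) : MvPowerSeries σ R)).prod) ≠ 0 →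
      d = Multiset.toFinsupp ((s : Multiset ℕ).map f) := by
    intro s hs
    rw [hmon, coeff_monomial] at hs
    by_contra h
    exact hs (if_neg h)
  intro s hs t ht
  have := (key s hs).symm.trans (key t ht)
  exact Subtype.ext (Multiset.map_injective hf (Multiset.toFinsupp.injective this))

theorem summable_X_pow {f : ℕ → σ} (hf : Function.Injective f) {r : ℕ} (hr : r ≠ 0) :
    Summable fun i => (X (f i) : MvPowerSeries σ R) ^ r := by
  classical
  refine summable_of_finite_coeff_ne_zero fun d => Set.Subsingleton.finite ?_
  have key : ∀ i, coeff d ((X (f i) : MvPowerSeries σ R) ^ r) ≠ 0 →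
      d = Finsupp.single (f i) r := by
    intro i hi
    rw [coeff_X_pow] at hi
    by_contra h
    exact hi (if_neg h)
  intro s hs t ht
  have := (key s hs).symm.trans (key t ht)
  exact hf (Finsupp.single_left_injective hr this)

theorem alternant_bot_ne_zero {S : Type*} [CommRing S] [IsDomain S] {n : ℕ} {y : Fin n → S}
    (hy : Function.Injective y) : alternant y ⊥ ≠ 0 := by
  have h : alternant y ⊥ = ((Matrix.vandermonde y).submatrix id Fin.revPerm).det := by
    rw [alternant]
    congr 1
    ext i j
    simp only [Matrix.of_apply, Matrix.submatrix_apply, Matrix.vandermonde_apply, id, beta,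
      rowLen_bot, Fin.revPerm_apply, Fin.val_rev, zero_add]
    congr 1
    have := j.2
    omega
  rw [h, Matrix.det_permute']
  refine mul_ne_zero ?_ (Matrix.det_vandermonde_ne_zero_iff.2 hy)
  rcases Int.units_eq_one_or (Equiv.Perm.sign (Fin.revPerm (n := n))) with h | h <;> simp [h]

end Variables

/-! ### The Cauchy identity -/

section Cauchy

open MvPowerSeries Filter Topology

/-- The diagrams with at most `D` cells. -/
def diagramsCardLe (D : ℕ) : Finset YoungDiagram := (finite_setOf_card_le D).toFinset

theorem mem_diagramsCardLe {D : ℕ} {l : YoungDiagram} : l ∈ diagramsCardLe D ↔ l.card ≤ D := by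
  simp [diagramsCardLe]

theorem mem_boxDiagrams_of_card_le {D n N : ℕ} {l : YoungDiagram} (hl : l.card ≤ D)
    (hc : l.colLen 0 ≤ n) (hN : D + n ≤ N) : l ∈ boxDiagrams n N := by
  refine mem_boxDiagrams.2 ⟨hc, fun i => ?_⟩
  have := rowLen_zero_le_card l
  have := l.rowLen_anti 0 i (Nat.zero_le _)
  have := i.2
  simp only [beta]
  omega

variable {σ R : Type*} [CommRing R] [TopologicalSpace R] [IsTopologicalRing R] {w : σ → ℕ}

/-- Cauchy–Binet pairs the minors of the Toeplitz matrix of G with those of (y_i^a). In the limit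
the (j, i) entry of the product is G(y_i) y_i^{β_η(j)}, so ∏ G(y_i) factors out of an alternant. -/
theorem tendsto_sum_boxDiagrams {n : ℕ} {G : PowerSeries (MvPowerSeries σ R)}
    {y Gy : Fin n → MvPowerSeries σ R}
    (hG : ∀ i, HasSum (fun r => PowerSeries.coeff r G * y i ^ r) (Gy i)) (η : YoungDiagram) :
    Tendsto (fun N => ∑ l ∈ boxDiagrams n N, jacobiTrudi G n l η * alternant y l) atTop
      (𝓝 ((∏ i, Gy i) * alternant y η)) := by
  have h1 : ∀ N, ∑ l ∈ boxDiagrams n N, jacobiTrudi G n l η * alternant y l =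
      Matrix.det (Matrix.of fun j i : Fin n => ∑ a ∈ Finset.range N,
        zcoeff G ((a : ℤ) - beta n η j) * y i ^ a) := by
    intro N
    rw [← cauchyBinet n N (fun j a => zcoeff G ((a : ℤ) - beta n η j)) (fun a i => y i ^ a)]
    refine Finset.sum_congr rfl fun l _ => ?_
    congr 1
    · rw [jacobiTrudi_eq_det_beta, ← Matrix.det_transpose]; rfl
    · rw [alternant, ← Matrix.det_transpose]; rfl
  have h2 : (∏ i, Gy i) * alternant y η =
      Matrix.det (Matrix.of fun j i : Fin n => Gy i * y i ^ beta n η j) := by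
    rw [alternant, ← Matrix.det_transpose, ← Matrix.det_mul_row]; rfl
  rw [h2]
  simp_rw [h1, Matrix.det_apply, Matrix.of_apply]
  refine tendsto_finsetSum _ fun τ _ => ?_
  simp_rw [Units.smul_def, zsmul_eq_mul]
  refine tendsto_const_nhds.mul (tendsto_finsetProd _ fun i _ => ?_)
  -- Terms with a below the exponent β_η vanish, so shifting N by it leaves exactly the partial sums
  -- of G(y_i).
  rw [← tendsto_add_atTop_iff_nat (beta n η (τ i))]
  have h3 : ∀ N, ∑ a ∈ Finset.range (N + beta n η (τ i)),
      zcoeff G ((a : ℤ) - beta n η (τ i)) * y i ^ a =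
      (∑ r ∈ Finset.range N, PowerSeries.coeff r G * y i ^ r) * y i ^ beta n η (τ i) := by
    intro N
    rw [add_comm N, Finset.sum_range_add, Finset.sum_eq_zero, zero_add, Finset.sum_mul]
    · refine Finset.sum_congr rfl fun r _ => ?_
      rw [zcoeff_sub_of_le _ (by omega), Nat.add_sub_cancel_left, pow_add]
      ring
    · intro a ha
      rw [zcoeff_sub_of_lt _ (Finset.mem_range.1 ha), zero_mul]
  simp_rw [h3]
  exact (hG i).tendsto_sum_nat.mul tendsto_const_nhds

/-- By the bialternant formula, both sides of the previous limit carry the Vandermonde factor, which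
cancels in a domain. The bound `hd` ensures that every diagram with at most weight(d) cells fits
into n rows. -/
theorem sum_coeff_jacobiTrudi_mul [T2Space R] [IsDomain R] {n : ℕ} {G : PowerSeries (MvPowerSeries σ R)}
    {y Gy : Fin n → MvPowerSeries σ R} (hy : Function.Injective y)
    (hyw : ∀ i, IsHomog w (y i) 1)
    (hGw : ∀ k, IsHomog w (PowerSeries.coeff k G) 0)
    (hG : ∀ i, HasSum (fun r => PowerSeries.coeff r G * y i ^ r) (Gy i)) (η : YoungDiagram)
    {d : σ →₀ ℕ} (hd : Finsupp.weight w d ≤ n) :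
    ∑ l ∈ diagramsCardLe (Finsupp.weight w d),
      coeff d (jacobiTrudi G n l η * jacobiTrudi (∏ i, geom (y i)) n l ⊥) =
    coeff d ((∏ i, Gy i) * jacobiTrudi (∏ i, geom (y i)) n η ⊥) := by
  classical
  have hF : ∀ k, IsHomog w (PowerSeries.coeff k (∏ i, geom (y i))) (1 * k) :=
    isHomog_coeff_prod _ fun i => isHomog_coeff_geom (hyw i)
  set t : YoungDiagram → MvPowerSeries σ R :=
    fun l => jacobiTrudi G n l η * jacobiTrudi (∏ i, geom (y i)) n l ⊥ with ht
  have hGjt := fun l => isHomog_jacobiTrudi_zero hGw n l η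
  have hcoef : ∀ l : YoungDiagram, l.colLen 0 ≤ n → IsHomog w (t l) l.card := by
    intro l hl
    have h1 := (hGjt l).mul (isHomog_jacobiTrudi hF hl)
    rwa [one_mul, zero_add] at h1
  -- The l-th term is homogeneous of weight |l|, so each coefficient of the box sums is eventually
  -- constant; S collects these values.
  set S : MvPowerSeries σ R := fun d => ∑ l ∈ (diagramsCardLe (Finsupp.weight w d)).filter
    (fun l => l.colLen 0 ≤ n), coeff d (t l) with hS
  have hSc : ∀ d, coeff d S = ∑ l ∈ (diagramsCardLe (Finsupp.weight w d)).filter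
    (fun l => l.colLen 0 ≤ n), coeff d (t l) := fun d => rfl
  have hlim : Tendsto (fun N => ∑ l ∈ boxDiagrams n N, t l) atTop (𝓝 S) := by
    rw [WithPiTopology.tendsto_iff_coeff_tendsto]
    intro d
    refine tendsto_const_nhds.congr' ?_
    filter_upwards [eventually_ge_atTop (Finsupp.weight w d + n)] with N hN
    rw [hSc, map_sum]
    refine Finset.sum_subset ?_ ?_
    · intro l hl
      rw [Finset.mem_filter, mem_diagramsCardLe] at hl
      exact mem_boxDiagrams_of_card_le hl.1 hl.2 hN
    · intro l hl hn
      rw [mem_boxDiagrams] at hl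
      rw [Finset.mem_filter, mem_diagramsCardLe, not_and_or] at hn
      refine (hcoef l hl.1).coeff_eq_zero d ?_
      rcases hn with hn | hn
      · omega
      · exact absurd hl.1 hn
  have h2 : alternant y ⊥ * S = alternant y ⊥ *
      ((∏ i, Gy i) * jacobiTrudi (∏ i, geom (y i)) n η ⊥) := by
    have h3 := tendsto_sum_boxDiagrams hG η
    rw [alternant_eq_mul_jacobiTrudi] at h3
    have h4 := (tendsto_const_nhds (x := alternant y ⊥)).mul hlim
    rw [mul_left_comm] at h3
    refine tendsto_nhds_unique h4 (h3.congr fun N => ?_)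
    rw [Finset.mul_sum]
    refine Finset.sum_congr rfl fun l _ => ?_
    rw [alternant_eq_mul_jacobiTrudi, ht]
    ring
  have : IsDomain (MvPowerSeries σ R) := NoZeroDivisors.to_isDomain _
  rw [← mul_left_cancel₀ (alternant_bot_ne_zero hy) h2, hSc, Finset.filter_true_of_mem]
  intro l hl
  rw [mem_diagramsCardLe] at hl
  exact (colLen_zero_le_card l).trans (hl.trans hd)

/-- The Cauchy identity for an infinite alphabet of variables, from kernels on finite alphabets. -/
theorem hasSum_mul_schur [T2Space R] [IsDomain R] {f : ℕ → σ} (hf : Function.Injective f)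
    (hfw : ∀ i, w (f i) = 1) {G : ℕ → PowerSeries (MvPowerSeries σ R)}
    (hGw : ∀ N k, IsHomog w (PowerSeries.coeff k (G N)) 0)
    {Gy : ℕ → ℕ → MvPowerSeries σ R}
    (hG : ∀ N i, HasSum (fun r => PowerSeries.coeff r (G N) * X (f i) ^ r) (Gy N i))
    {K : MvPowerSeries σ R}
    (hK : Tendsto (fun N => ∏ i ∈ Finset.range N, Gy N i) atTop (𝓝 K)) {η : YoungDiagram}
    {c : YoungDiagram → MvPowerSeries σ R}
    (hc : ∀ l, Tendsto (fun N => jacobiTrudi (G N) N l η) atTop (𝓝 (c l))) :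
    HasSum (fun l => c l * schur (fun i => X (f i)) l)
      (K * schur (fun i => X (f i)) η) := by
  have hX := hSummable_X (R := R) hf
  have hXw : ∀ i, IsHomog w (X (f i) : MvPowerSeries σ R) 1 := fun i => by
    have := isHomog_X (R := R) (w := w) (f i)
    rwa [hfw] at this
  have hcw : ∀ l, IsHomog w (c l) 0 := fun l =>
    isHomog_of_tendsto (hc l) fun N => isHomog_jacobiTrudi_zero (hGw N) N l η
  have hschur : ∀ l : YoungDiagram, Tendsto
      (fun N => jacobiTrudi (∏ i : Fin N, geom (X (f i) : MvPowerSeries σ R)) N l ⊥) atTop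
      (𝓝 (schur (fun i => X (f i)) l)) := by
    intro l
    rw [schur_eq_jacobiTrudi _ le_rfl]
    refine (tendsto_jacobiTrudi hX.tendsto_coeff_prod_geom (l.colLen 0) l ⊥).congr' ?_
    filter_upwards [eventually_ge_atTop (l.colLen 0)] with N hN
    rw [Fin.prod_univ_eq_prod_range (fun i => geom (X (f i) : MvPowerSeries σ R)) N,
      jacobiTrudi_eq_of_le (constantCoeff_prod_geom _ _) le_rfl (by simp) hN]
  rw [WithPiTopology.hasSum_iff_hasSum_coeff]
  intro d
  -- The same N is the number of variables and the index of the kernel. The finite identity holds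
  -- once N ≥ weight(d), and its two sides converge separately.
  have h1 : ∑ l ∈ diagramsCardLe (Finsupp.weight w d),
      coeff d (c l * schur (fun i => X (f i)) l) = coeff d (K * schur (fun i => X (f i)) η) := by
    have h2 := tendsto_finsetSum (diagramsCardLe (Finsupp.weight w d)) fun l _ =>
      (WithPiTopology.tendsto_iff_coeff_tendsto _ _ _).1 ((hc l).mul (hschur l)) d
    have h3 := (WithPiTopology.tendsto_iff_coeff_tendsto _ _ _).1 (hK.mul (hschur η)) d
    refine tendsto_nhds_unique h2 (h3.congr' ?_)
    filter_upwards [eventually_ge_atTop (Finsupp.weight w d)] with N hN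
    rw [sum_coeff_jacobiTrudi_mul (y := fun i : Fin N => X (f i)) (Gy := fun i : Fin N => Gy N i)
      (fun i j h => Fin.ext (hf (X_inj.1 h))) (fun i => hXw i) (hGw N) (fun i => hG N i) η hN,
      Fin.prod_univ_eq_prod_range (fun i => Gy N i)]
  rw [← h1]
  refine hasSum_sum_of_ne_finset_zero fun l hl => ?_
  rw [mem_diagramsCardLe] at hl
  have h4 := (hcw l).mul (isHomog_schur hX hXw l)
  rw [one_mul, zero_add] at h4
  refine h4.coeff_eq_zero d ?_
  omega

end Cauchy

/-! ### Evaluation of power series -/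

section Evaluation

open MvPowerSeries Filter Topology

variable {σ R : Type*} [CommRing R]

theorem coeff_mul_pow_eq_zero {y : MvPowerSeries σ R} (hy : constantCoeff y = 0)
    (c : MvPowerSeries σ R) {k : ℕ} {d : σ →₀ ℕ} (h : d.degree < k) : coeff d (c * y ^ k) = 0 := by
  apply coeff_of_lt_order
  refine lt_of_lt_of_le ?_ le_order_mul
  refine lt_of_lt_of_le ?_ (le_add_of_nonneg_left zero_le)
  exact lt_of_lt_of_le (by exact_mod_cast h) (le_order_pow_of_constantCoeff_eq_zero k hy)

theorem coeff_pow_eq_zero_of_degree_lt {y : MvPowerSeries σ R} (hy : constantCoeff y = 0) {k : ℕ}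
    {d : σ →₀ ℕ} (h : d.degree < k) : coeff d (y ^ k) = 0 := by
  rw [← one_mul (y ^ k)]
  exact coeff_mul_pow_eq_zero hy 1 h

variable [TopologicalSpace R]

theorem hasSum_eval_one_add (z y : MvPowerSeries σ R) :
    HasSum (fun r => PowerSeries.coeff r (1 + PowerSeries.C z * PowerSeries.X) * y ^ r)
      (1 + z * y) := by
  have h := hasSum_sum_of_ne_finset_zero (s := Finset.range 2)
    (f := fun r => PowerSeries.coeff r (1 + PowerSeries.C z * PowerSeries.X) * y ^ r)
    (L := .unconditional ℕ) fun r hr => by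
      rw [Finset.mem_range] at hr
      rw [map_add, PowerSeries.coeff_one, PowerSeries.coeff_C_mul, PowerSeries.coeff_X,
        if_neg (by omega), if_neg (by omega)]
      simp
  simpa [Finset.sum_range_succ, PowerSeries.coeff_X, PowerSeries.coeff_one] using h

theorem hasSum_eval_geom (z : MvPowerSeries σ R) {y : MvPowerSeries σ R}
    (hy : constantCoeff y = 0) :
    HasSum (fun r => PowerSeries.coeff r (geom z) * y ^ r) (∑' r : ℕ, (z * y) ^ r) := by
  simp_rw [coeff_geom, ← mul_pow]
  exact (WithPiTopology.summable_pow_of_constantCoeff_eq_zero (by rw [map_mul, hy, mul_zero])).hasSum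

variable [IsTopologicalRing R] [T2Space R]

/-- By `hs` only finitely many pairs (a, b) reach a given coefficient, so the double family is
summable and can be regrouped along antidiagonals. -/
theorem hasSum_antidiagonal {f g : ℕ → MvPowerSeries σ R} {A B : MvPowerSeries σ R}
    (hf : HasSum f A) (hg : HasSum g B)
    (hs : ∀ d a b, d.degree < a ∨ d.degree < b → coeff d (f a * g b) = 0) :
    HasSum (fun n => ∑ x ∈ Finset.HasAntidiagonal.antidiagonal n, f x.1 * g x.2) (A * B) := by
  have : T3Space (MvPowerSeries σ R) := inferInstance
  have hs : Summable fun x : ℕ × ℕ => f x.1 * g x.2 := by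
    refine summable_of_finite_coeff_ne_zero fun d =>
      (Finset.finite_toSet (Finset.range (d.degree + 1) ×ˢ Finset.range (d.degree + 1))).subset ?_
    rintro ⟨a, b⟩ h
    rw [Finset.mem_coe, Finset.mem_product, Finset.mem_range, Finset.mem_range]
    by_contra hcon
    exact h (hs d a b (by simp only at hcon ⊢; omega))
  have h1 := hf.summable.tsum_mul_tsum_eq_tsum_sum_antidiagonal hg.summable hs
  rw [hf.tsum_eq, hg.tsum_eq] at h1
  rw [h1]
  exact (summable_sum_mul_antidiagonal_of_summable_mul hs).hasSum

theorem hasSum_eval_mul {G H : PowerSeries (MvPowerSeries σ R)} {y A B : MvPowerSeries σ R}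
    (hy : constantCoeff y = 0) (hG : HasSum (fun r => PowerSeries.coeff r G * y ^ r) A)
    (hH : HasSum (fun r => PowerSeries.coeff r H * y ^ r) B) :
    HasSum (fun r => PowerSeries.coeff r (G * H) * y ^ r) (A * B) := by
  have hterm : ∀ a b, PowerSeries.coeff a G * y ^ a * (PowerSeries.coeff b H * y ^ b) =
      PowerSeries.coeff a G * PowerSeries.coeff b H * y ^ (a + b) := fun a b => by
    rw [pow_add]; ring
  have h := hasSum_antidiagonal hG hH fun d a b hab => by
    rw [hterm]
    exact coeff_mul_pow_eq_zero hy _ (by omega)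
  refine (congrArg (HasSum · (A * B)) (funext fun r => ?_)).mpr h
  rw [PowerSeries.coeff_mul, Finset.sum_mul]
  refine Finset.sum_congr rfl fun x hx => ?_
  rw [hterm, Finset.HasAntidiagonal.mem_antidiagonal.1 hx]

theorem hasSum_eval_prod {ι : Type*} (s : Finset ι) {G : ι → PowerSeries (MvPowerSeries σ R)}
    {y : MvPowerSeries σ R} {A : ι → MvPowerSeries σ R} (hy : constantCoeff y = 0)
    (hG : ∀ i, HasSum (fun r => PowerSeries.coeff r (G i) * y ^ r) (A i)) :
    HasSum (fun r => PowerSeries.coeff r (∏ i ∈ s, G i) * y ^ r) (∏ i ∈ s, A i) := by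
  classical
  induction s using Finset.induction_on with
  | empty =>
    rw [Finset.prod_empty, Finset.prod_empty]
    convert hasSum_single (f := fun r => PowerSeries.coeff r (1 : PowerSeries (MvPowerSeries σ R)) *
      y ^ r) 0 fun r hr => ?_
    · simp
    · rw [PowerSeries.coeff_one, if_neg hr, zero_mul]
  | insert i s hi ih =>
    rw [Finset.prod_insert hi, Finset.prod_insert hi]
    exact hasSum_eval_mul hy (hG i) ih

end Evaluation

/-! ### Exponentials and logarithms -/

section Exponential

open Filter Topology MvPowerSeries

theorem hasSum_subst (P : PowerSeries Coeff) {F : Series} (hF : constantCoeff F = 0) :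
    HasSum (fun n => PowerSeries.coeff n P • F ^ n) (P.subst F) := by
  have hs := PowerSeries.HasSubst.of_constantCoeff_zero hF
  rw [WithPiTopology.hasSum_iff_hasSum_coeff]
  intro d
  rw [PowerSeries.coeff_subst hs, finsum_eq_sum_of_support_subset (s := Finset.range (d.degree + 1))]
  · simp_rw [coeff_smul]
    refine hasSum_sum_of_ne_finset_zero fun n hn => ?_
    rw [coeff_pow_eq_zero_of_degree_lt hF (by rw [Finset.mem_range] at hn; omega), mul_zero]
  · intro n hn
    rw [Finset.mem_coe, Finset.mem_range]
    by_contra hcon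
    refine hn ?_
    change _ • _ = _
    rw [coeff_pow_eq_zero_of_degree_lt hF (by omega), smul_zero]

theorem coeff_subst_eq_sum (P : PowerSeries Coeff) {F : Series} (hF : constantCoeff F = 0)
    (d : ℕ ⊕ ℕ →₀ ℕ) : coeff d (P.subst F) =
      ∑ n ∈ Finset.range (d.degree + 1), PowerSeries.coeff n P * coeff d (F ^ n) := by
  refine ((WithPiTopology.hasSum_iff_hasSum_coeff.1 (hasSum_subst P hF) d).unique ?_)
  simp_rw [coeff_smul]
  refine hasSum_sum_of_ne_finset_zero fun n hn => ?_
  rw [coeff_pow_eq_zero_of_degree_lt hF (by rw [Finset.mem_range] at hn; omega), mul_zero]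

theorem tendsto_expSeries {ι : Type*} {𝓕 : Filter ι} {F : ι → Series} {G : Series}
    (hF : ∀ i, constantCoeff (F i) = 0) (hG : constantCoeff G = 0) (h : Tendsto F 𝓕 (𝓝 G)) :
    Tendsto (fun i => expSeries (F i)) 𝓕 (𝓝 (expSeries G)) := by
  rw [WithPiTopology.tendsto_iff_coeff_tendsto]
  intro d
  simp_rw [expSeries]
  rw [coeff_subst_eq_sum _ hG]
  simp_rw [fun i => coeff_subst_eq_sum (PowerSeries.exp Coeff) (hF i) d]
  exact tendsto_finsetSum _ fun n _ => tendsto_const_nhds.mul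
    ((WithPiTopology.tendsto_iff_coeff_tendsto _ _ _).1 (h.pow n) d)

theorem expSeries_add {F G : Series} (hF : constantCoeff F = 0) (hG : constantCoeff G = 0) :
    expSeries (F + G) = expSeries F * expSeries G := by
  have h1 := hasSum_subst (PowerSeries.exp Coeff) hF
  have h2 := hasSum_subst (PowerSeries.exp Coeff) hG
  have h3 := hasSum_subst (PowerSeries.exp Coeff) (F := F + G) (by rw [map_add, hF, hG, add_zero])
  have h4 := hasSum_antidiagonal h1 h2 fun d a b h => by
    rw [smul_mul_assoc, mul_smul_comm, coeff_smul, coeff_smul]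
    rcases h with ha | hb
    · rw [mul_comm (F ^ a), coeff_mul_pow_eq_zero hF _ ha, mul_zero, mul_zero]
    · rw [coeff_mul_pow_eq_zero hG _ hb, mul_zero, mul_zero]
  rw [expSeries, expSeries, expSeries, ← h4.tsum_eq, ← h3.tsum_eq]
  congr 1
  funext n
  rw [(Commute.all F G).add_pow', Finset.smul_sum]
  refine Finset.sum_congr rfl fun x hx => ?_
  rw [smul_mul_smul_comm, ← Nat.cast_smul_eq_nsmul Coeff, smul_smul]
  congr 1
  have hx := Finset.HasAntidiagonal.mem_antidiagonal.1 hx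
  rw [PowerSeries.coeff_exp, PowerSeries.coeff_exp, PowerSeries.coeff_exp,
    ← map_natCast (algebraMap ℚ Coeff), ← map_mul, ← map_mul, ← hx]
  congr 1
  have h5 := Nat.add_choose_mul_factorial_mul_factorial x.1 x.2
  rw [← Nat.choose_symm_add] at h5
  have h6 : ((x.1 + x.2).choose x.1 : ℚ) * x.1.factorial * x.2.factorial =
    (x.1 + x.2).factorial := by exact_mod_cast h5
  have := Nat.factorial_ne_zero x.1
  have := Nat.factorial_ne_zero x.2
  have := Nat.factorial_ne_zero (x.1 + x.2)
  field_simp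
  linarith

theorem expSeries_zero : expSeries 0 = 1 := by
  have h := (hasSum_subst (PowerSeries.exp Coeff) (F := 0) (map_zero _)).unique
    (hasSum_single 0 fun n hn => by rw [zero_pow hn, smul_zero])
  rw [expSeries, h]
  simp

theorem expSeries_sum {ι : Type*} (s : Finset ι) {F : ι → Series}
    (hF : ∀ i ∈ s, constantCoeff (F i) = 0) :
    expSeries (∑ i ∈ s, F i) = ∏ i ∈ s, expSeries (F i) := by
  classical
  induction s using Finset.induction_on with
  | empty => exact expSeries_zero
  | insert a s ha ih =>
    have h1 : ∀ i ∈ s, constantCoeff (F i) = 0 := fun i hi => hF i (Finset.mem_insert_of_mem hi)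
    rw [Finset.sum_insert ha, Finset.prod_insert ha, ← ih h1,
      expSeries_add (hF a (Finset.mem_insert_self a s))]
    rw [map_sum]
    exact Finset.sum_eq_zero h1

/-- Let f = exp ∘ log and L = log' = 1/(1+X). Then f' = fL and L' = -L², so (fL)' = 0; the constant
term gives fL = 1, hence f = 1 + X. -/
theorem exp_subst_log : (PowerSeries.exp Coeff).subst (PowerSeries.log Coeff) =
    1 + PowerSeries.X := by
  have hs : PowerSeries.HasSubst (PowerSeries.log Coeff) := PowerSeries.HasSubst.log
  set f : PowerSeries Coeff := (PowerSeries.exp Coeff).subst (PowerSeries.log Coeff) with hf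
  set L : PowerSeries Coeff := PowerSeries.derivative Coeff (PowerSeries.log Coeff) with hL
  have h1 : PowerSeries.derivative Coeff f = f * L := by
    rw [hf, PowerSeries.derivative_subst hs, PowerSeries.derivative_exp]
  have h2 : (1 + PowerSeries.X) * L = 1 := by
    have hLg : L = geom (-1) := by
      rw [hL, PowerSeries.deriv_log]
      ext1 n
      simp
    have := one_sub_mul_geom (-1 : Coeff)
    rw [hLg]
    simpa using this
  have h3 : PowerSeries.derivative Coeff L = -(L * L) := by
    have h4 := congrArg (PowerSeries.derivative Coeff) h2
    rw [Derivation.leibniz, map_add, PowerSeries.derivative_X, Derivation.map_one_eq_zero,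
      smul_eq_mul, smul_eq_mul, zero_add, mul_one] at h4
    linear_combination L * h4 - PowerSeries.derivative Coeff L * h2
  have hf0 : PowerSeries.constantCoeff f = 1 := by
    have h6 : PowerSeries.constantCoeff
        ((PowerSeries.exp Coeff - 1).subst (PowerSeries.log Coeff) : PowerSeries Coeff) = 0 :=
      PowerSeries.constantCoeff_subst_eq_zero PowerSeries.constantCoeff_log _ (by simp)
    have h7 : ((PowerSeries.exp Coeff - 1).subst (PowerSeries.log Coeff) :
        PowerSeries Coeff) = f - 1 := by
      rw [hf, ← PowerSeries.coe_substAlgHom (R := Coeff) hs]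
      refine (map_sub (PowerSeries.substAlgHom (R := Coeff) hs) _ _).trans
        ?_
      rw [map_one (PowerSeries.substAlgHom (R := Coeff) hs)]
    rwa [h7, map_sub, map_one, sub_eq_zero] at h6
  have h5 : f * L = 1 := by
    have : CharZero Coeff := algebraRat.charZero Coeff
    apply PowerSeries.derivative.ext
    · rw [Derivation.leibniz, h1, h3, Derivation.map_one_eq_zero]
      simp only [smul_eq_mul]
      ring
    · have hL0 := congrArg PowerSeries.constantCoeff h2
      rw [map_mul, map_add, map_one, PowerSeries.constantCoeff_X, add_zero, one_mul] at hL0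
      rw [map_mul, hf0, hL0, map_one, mul_one]
  linear_combination (1 + PowerSeries.X) * h5 - f * h2

theorem hasSum_of_coeff_eq_zero {F : ℕ+ → Series}
    (h : ∀ (k : ℕ+) (d : ℕ ⊕ ℕ →₀ ℕ), d.degree < k → coeff d (F k) = 0) (d : ℕ ⊕ ℕ →₀ ℕ) :
    HasSum (fun k => coeff d (F k)) (∑ k ∈ Finset.Icc 1 (Nat.succPNat d.degree), coeff d (F k)) :=
  hasSum_sum_of_ne_finset_zero fun k hk => h k d <| by
    rw [Finset.mem_Icc, not_and] at hk
    have := hk (one_le (a := k))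
    rw [not_le, ← PNat.coe_lt_coe, Nat.succPNat_coe] at this
    omega

theorem summable_of_coeff_eq_zero {F : ℕ+ → Series}
    (h : ∀ (k : ℕ+) (d : ℕ ⊕ ℕ →₀ ℕ), d.degree < k → coeff d (F k) = 0) : Summable F :=
  WithPiTopology.summable_iff_summable_coeff.2 fun d => (hasSum_of_coeff_eq_zero h d).summable

theorem coeff_tsum_eq_sum {F : ℕ+ → Series}
    (h : ∀ (k : ℕ+) (d : ℕ ⊕ ℕ →₀ ℕ), d.degree < k → coeff d (F k) = 0) (d : ℕ ⊕ ℕ →₀ ℕ) :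
    coeff d (∑' k, F k) = ∑ k ∈ Finset.Icc 1 (Nat.succPNat d.degree), coeff d (F k) :=
  (WithPiTopology.hasSum_iff_hasSum_coeff.1 (summable_of_coeff_eq_zero h).hasSum d).unique
    (hasSum_of_coeff_eq_zero h d)

theorem constantCoeff_tsum_eq_zero {F : ℕ+ → Series}
    (h : ∀ (k : ℕ+) (d : ℕ ⊕ ℕ →₀ ℕ), d.degree < k → coeff d (F k) = 0) :
    constantCoeff (∑' k, F k) = 0 := by
  rw [← coeff_zero_eq_constantCoeff_apply, coeff_tsum_eq_sum h]
  exact Finset.sum_eq_zero fun k _ => h k 0 (by simp)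

theorem coeff_smul_pow_eq_zero (c : ℕ+ → Coeff) {z : Series} (hz : constantCoeff z = 0) (k : ℕ+)
    (d : ℕ ⊕ ℕ →₀ ℕ) (h : d.degree < k) : coeff d (c k • z ^ (k : ℕ)) = 0 := by
  rw [coeff_smul, coeff_pow_eq_zero_of_degree_lt hz h, mul_zero]

theorem expSeries_log_one_add {z : Series} (hz : constantCoeff z = 0) :
    expSeries (∑' k : ℕ+, ((-1) ^ ((k : ℕ) + 1) * ((k : ℕ) : Coeff)⁻¹) • z ^ (k : ℕ)) = 1 + z := by
  have hs := PowerSeries.HasSubst.of_constantCoeff_zero hz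
  have h1 : HasSum (fun k : ℕ+ => ((-1) ^ ((k : ℕ) + 1) * ((k : ℕ) : Coeff)⁻¹) • z ^ (k : ℕ))
      ((PowerSeries.log Coeff).subst z) := by
    have h2 := hasSum_subst (PowerSeries.log Coeff) hz
    rw [← PNat.coe_injective.hasSum_iff] at h2
    · refine (congrArg (HasSum · _) (funext fun k => ?_)).mp h2
      rw [Function.comp_apply, PowerSeries.coeff_log, if_neg k.ne_zero, map_div₀, map_pow, map_neg,
        map_one, map_natCast, div_eq_mul_inv]
    · intro n hn
      have : n = 0 := by
        by_contra h
        exact hn ⟨⟨n, Nat.pos_of_ne_zero h⟩, rfl⟩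
      rw [this, PowerSeries.coeff_log, if_pos rfl, zero_smul]
  rw [h1.tsum_eq, expSeries, ← PowerSeries.subst_comp_subst_apply PowerSeries.HasSubst.log hs,
    exp_subst_log, ← PowerSeries.coe_substAlgHom hs]
  exact (map_add (PowerSeries.substAlgHom hs) _ _).trans
    (congrArg₂ _ (map_one (PowerSeries.substAlgHom hs))
      ((congrFun (PowerSeries.coe_substAlgHom hs) _).trans (PowerSeries.subst_X hs)))

/-- The logarithm of 1 + (-z) is -∑ z^k/k. Hence the exponential sought is inverse to 1 - z, as is
the geometric series. -/
theorem expSeries_log_tsum_pow {z : Series} (hz : constantCoeff z = 0) :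
    expSeries (∑' k : ℕ+, ((k : ℕ) : Coeff)⁻¹ • z ^ (k : ℕ)) = ∑' r : ℕ, z ^ r := by
  have hz' : constantCoeff (-z) = 0 := by rw [map_neg, hz, neg_zero]
  set F : Series := ∑' k : ℕ+, ((k : ℕ) : Coeff)⁻¹ • z ^ (k : ℕ) with hF
  have hF0 : constantCoeff F = 0 :=
    constantCoeff_tsum_eq_zero (coeff_smul_pow_eq_zero (fun k => ((k : ℕ) : Coeff)⁻¹) hz)
  have h1 : expSeries (-F) = 1 - z := by
    rw [sub_eq_add_neg, ← expSeries_log_one_add hz', hF, ← tsum_neg]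
    congr 2
    funext k
    rw [neg_pow z, ← neg_smul, ← map_one (C (σ := ℕ ⊕ ℕ) (R := Coeff)), ← map_neg, ← map_pow,
      ← smul_eq_C_mul, smul_smul]
    congr 1
    rw [mul_right_comm, ← pow_add, show (k : ℕ) + 1 + k = 2 * k + 1 by ring, pow_succ, pow_mul]
    simp
  have h2 : expSeries (-F) * expSeries F = 1 := by
    rw [← expSeries_add (by rw [map_neg, hF0, neg_zero]) hF0, neg_add_cancel, expSeries_zero]
  have h3 := WithPiTopology.one_sub_mul_tsum_pow_of_constantCoeff_eq_zero hz
  rw [h1] at h2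
  linear_combination (∑' r : ℕ, z ^ r) * h2 - expSeries F * h3

/-- The exponential turns the double product into a sum in which power sums factor. Only the x_i
need vanishing constant term: this makes the k-th summand of order at least k, and the y_j may then
be scalars such as the letters of q^ρ. -/
theorem tendsto_prod_expSeries (c : ℕ+ → Coeff) {x y : ℕ → Series}
    (hx : ∀ i, constantCoeff (x i) = 0) {px py : ℕ+ → Series}
    (hpx : ∀ k : ℕ+, Tendsto (fun N => ∑ i ∈ Finset.range N, x i ^ (k : ℕ)) atTop (𝓝 (px k)))
    (hpy : ∀ k : ℕ+, Tendsto (fun N => ∑ j ∈ Finset.range N, y j ^ (k : ℕ)) atTop (𝓝 (py k))) :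
    Tendsto (fun N => ∏ i ∈ Finset.range N, ∏ j ∈ Finset.range N,
      expSeries (∑' k : ℕ+, c k • (y j * x i) ^ (k : ℕ))) atTop
      (𝓝 (expSeries (∑' k : ℕ+, c k • (py k * px k)))) := by
  have hyx : ∀ i j, constantCoeff (y j * x i) = 0 := fun i j => by rw [map_mul, hx, mul_zero]
  have hfin : ∀ (N : ℕ) (k : ℕ+) (d : ℕ ⊕ ℕ →₀ ℕ), d.degree < k → coeff d (c k •
      ((∑ j ∈ Finset.range N, y j ^ (k : ℕ)) * ∑ i ∈ Finset.range N, x i ^ (k : ℕ))) = 0 := by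
    intro N k d h
    rw [coeff_smul, Finset.mul_sum, map_sum, Finset.sum_eq_zero, mul_zero]
    exact fun i _ => coeff_mul_pow_eq_zero (hx i) _ h
  have hlim : ∀ k : ℕ+, Tendsto (fun N => c k •
      ((∑ j ∈ Finset.range N, y j ^ (k : ℕ)) * ∑ i ∈ Finset.range N, x i ^ (k : ℕ))) atTop
      (𝓝 (c k • (py k * px k))) := by
    intro k
    simp_rw [smul_eq_C_mul]
    exact tendsto_const_nhds.mul ((hpy k).mul (hpx k))
  have hinf : ∀ (k : ℕ+) (d : ℕ ⊕ ℕ →₀ ℕ), d.degree < k → coeff d (c k • (py k * px k)) = 0 := by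
    intro k d h
    have h1 := (WithPiTopology.tendsto_iff_coeff_tendsto _ _ _).1 (hlim k) d
    simp_rw [fun N => hfin N k d h] at h1
    exact tendsto_nhds_unique h1 tendsto_const_nhds
  have hprod : ∀ N, ∏ i ∈ Finset.range N, ∏ j ∈ Finset.range N,
      expSeries (∑' k : ℕ+, c k • (y j * x i) ^ (k : ℕ)) = expSeries (∑' k : ℕ+, c k •
      ((∑ j ∈ Finset.range N, y j ^ (k : ℕ)) * ∑ i ∈ Finset.range N, x i ^ (k : ℕ))) := by
    intro N
    rw [← Finset.prod_product', ← expSeries_sum _ fun p _ =>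
      constantCoeff_tsum_eq_zero (coeff_smul_pow_eq_zero c (hyx p.1 p.2)),
      ← Summable.tsum_finsetSum fun p _ =>
        summable_of_coeff_eq_zero (coeff_smul_pow_eq_zero c (hyx p.1 p.2))]
    congr 2
    funext k
    rw [← Finset.smul_sum, Finset.sum_product, Finset.sum_mul_sum, Finset.sum_comm]
    simp_rw [mul_pow]
  simp_rw [hprod]
  refine tendsto_expSeries (fun N => constantCoeff_tsum_eq_zero (hfin N))
    (constantCoeff_tsum_eq_zero hinf) ?_
  rw [WithPiTopology.tendsto_iff_coeff_tendsto]
  intro d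
  rw [coeff_tsum_eq_sum hinf]
  simp_rw [fun N => coeff_tsum_eq_sum (hfin N) d]
  exact tendsto_finsetSum _ fun k _ =>
    (WithPiTopology.tendsto_iff_coeff_tendsto _ _ _).1 (hlim k) d

end Exponential

/-! ### Limits of Jacobi–Trudi determinants -/

section Limits

open Filter Topology PowerSeries

variable {A : Type*} [CommRing A]

theorem prod_geom_mul_evalNegHom {ι : Type*} (s : Finset ι) (z : ι → A) :
    (∏ i ∈ s, geom (z i)) * evalNegHom (∏ i ∈ s, (1 + C (z i) * X)) = 1 := by
  rw [map_prod, ← Finset.prod_mul_distrib]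
  refine Finset.prod_eq_one fun i _ => ?_
  have h : evalNegHom (1 + C (z i) * X) = 1 - C (z i) * X := by
    ext k
    rw [evalNegHom, coeff_rescale]
    rcases k with _ | _ | k <;> simp [coeff_one]
  rw [h, mul_comm, one_sub_mul_geom]

/-- ∏ (1 + z_j X) generates the elementary symmetric functions of the letters, so this is duality
read backwards. -/
theorem jacobiTrudi_prod_one_add {N : ℕ} (z : ℕ → A) {l m : YoungDiagram}
    (hl : l.colLen 0 ≤ N) (hl' : l.rowLen 0 ≤ N) (hm : m.colLen 0 ≤ N) (hm' : m.rowLen 0 ≤ N) :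
    jacobiTrudi (∏ j ∈ Finset.range N, (1 + C (z j) * X)) N l m =
      jacobiTrudi (∏ j ∈ Finset.range N, geom (z j)) N l.transpose m.transpose := by
  rw [jacobiTrudi_transpose (N := N) (constantCoeff_prod_geom _ _)
    (prod_geom_mul_evalNegHom (Finset.range N) z), YoungDiagram.transpose_transpose,
    YoungDiagram.transpose_transpose] <;>
  simpa only [YoungDiagram.colLen_transpose, YoungDiagram.rowLen_transpose]

variable [TopologicalSpace A] [IsTopologicalRing A]

/-- The number of letters and the size of the determinant grow together; by stability the size can
be frozen first. -/
theorem HSummable.tendsto_jacobiTrudi_prod_geom {z : ℕ → A} (hz : HSummable z)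
    (l m : YoungDiagram) :
    Tendsto (fun N => jacobiTrudi (∏ j ∈ Finset.range N, geom (z j)) N l m) atTop
      (𝓝 (skewSchur z l m)) := by
  set n := max (l.colLen 0) (m.colLen 0)
  rw [skewSchur_eq_jacobiTrudi z (le_max_left _ _ : _ ≤ n) (le_max_right _ _)]
  refine (tendsto_jacobiTrudi hz.tendsto_coeff_prod_geom n l m).congr' ?_
  filter_upwards [eventually_ge_atTop n] with N hN
  rw [jacobiTrudi_eq_of_le (constantCoeff_prod_geom _ _) (le_max_left _ _ : _ ≤ n)
    (le_max_right _ _) hN]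

theorem HSummable.tendsto_jacobiTrudi_prod_one_add {z : ℕ → A} (hz : HSummable z)
    (l m : YoungDiagram) :
    Tendsto (fun N => jacobiTrudi (∏ j ∈ Finset.range N, (1 + C (z j) * X)) N l m) atTop
      (𝓝 (skewSchur z l.transpose m.transpose)) := by
  refine (hz.tendsto_jacobiTrudi_prod_geom l.transpose m.transpose).congr' ?_
  filter_upwards [eventually_ge_atTop (l.colLen 0), eventually_ge_atTop (l.rowLen 0),
    eventually_ge_atTop (m.colLen 0), eventually_ge_atTop (m.rowLen 0)] with N h1 h2 h3 h4
  rw [jacobiTrudi_prod_one_add z h1 h2 h3 h4]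

end Limits

theorem jacobiTrudi_map {A B : Type*} [CommRing A] [CommRing B] (φ : A →+* B) (F : PowerSeries A)
    (n : ℕ) (l m : YoungDiagram) :
    jacobiTrudi (PowerSeries.map φ F) n l m = φ (jacobiTrudi F n l m) := by
  rw [jacobiTrudi, jacobiTrudi, RingHom.map_det]
  congr 1
  ext i j
  rw [RingHom.mapMatrix_apply, Matrix.map_apply, Matrix.of_apply, Matrix.of_apply, zcoeff, zcoeff]
  split_ifs
  · rw [map_zero]
  · rw [PowerSeries.coeff_map]

/-! ### Adams operations on power sums -/

section Adams

open MvPowerSeries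

theorem coeff_powerSum_X {σ R : Type*} [CommRing R] [TopologicalSpace R] [T2Space R] {f : ℕ → σ}
    (hf : Function.Injective f) {r : ℕ} (hr : r ≠ 0) (d : σ →₀ ℕ)
    [Decidable (∃ i, Finsupp.single (f i) r = d)] :
    coeff d (powerSum (fun i => (X (f i) : MvPowerSeries σ R)) r) =
      if ∃ i, Finsupp.single (f i) r = d then 1 else 0 := by
  classical
  refine (WithPiTopology.hasSum_iff_hasSum_coeff.1
    (summable_X_pow (R := R) hf hr).hasSum d).unique ?_
  have hne : ∀ i, Finsupp.single (f i) r ≠ d →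
      coeff d ((X (f i) : MvPowerSeries σ R) ^ r) = 0 := fun i hi => by
    rw [coeff_X_pow, if_neg (Ne.symm hi)]
  split_ifs with h
  · obtain ⟨i, rfl⟩ := h
    have h1 := hasSum_single (L := .unconditional ℕ)
      (f := fun j => coeff (Finsupp.single (f i) r) ((X (f j) : MvPowerSeries σ R) ^ r))
      i fun j hj => hne j fun hji => hj (hf (Finsupp.single_left_injective hr hji))
    rwa [coeff_X_pow, if_pos rfl] at h1
  · push Not at h
    simp_rw [fun i => hne i (h i)]
    exact hasSum_zero

theorem adams_powerSum_X {f : ℕ → ℕ ⊕ ℕ} (hf : Function.Injective f) (k : ℕ+) :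
    adams k (powerSum (fun i => (X (f i) : Series)) 1) =
      powerSum (fun i => (X (f i) : Series)) k := by
  classical
  refine MvPowerSeries.ext fun d => ?_
  rw [coeff_powerSum_X hf k.ne_zero]
  change coeff d (MvPowerSeries.expand (k : ℕ) k.ne_zero (MvPowerSeries.map (adamsCoeff k) _)) = _
  -- Expansion is supported on multiples of k, and k · e is k times a unit vector exactly when e is
  -- a unit vector.
  by_cases h : ∀ i, (k : ℕ) ∣ d i
  · obtain ⟨e, rfl⟩ : ∃ e, (k : ℕ) • e = d :=
      ⟨d.mapRange (fun a => a / k) (by simp), by ext i; simp [Nat.mul_div_cancel' (h i)]⟩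
    rw [coeff_expand_smul, coeff_map, coeff_powerSum_X hf one_ne_zero, apply_ite (adamsCoeff k),
      map_one, map_zero]
    refine if_congr (exists_congr fun i => ?_) rfl rfl
    have h1 : Finsupp.single (f i) (k : ℕ) = (k : ℕ) • Finsupp.single (f i) 1 := by simp
    rw [h1]
    exact (smul_right_injective _ k.ne_zero).eq_iff.symm
  · push Not at h
    obtain ⟨i, hi⟩ := h
    rw [coeff_expand_of_not_dvd _ _ _ hi, if_neg]
    rintro ⟨j, rfl⟩
    rw [Finsupp.single_apply] at hi
    split_ifs at hi with h1
    · exact hi dvd_rfl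
    · exact hi (dvd_zero _)

theorem adams_smul (k : ℕ+) (c : Coeff) (F : Series) :
    adams k (c • F) = adamsCoeff k c • adams k F := by
  change (MvPowerSeries.expand (k : ℕ) k.ne_zero) (MvPowerSeries.map (adamsCoeff k) (c • F)) =
    adamsCoeff k c • (MvPowerSeries.expand (k : ℕ) k.ne_zero) (MvPowerSeries.map (adamsCoeff k) F)
  rw [← map_smul]
  congr 1
  refine MvPowerSeries.ext fun d => ?_
  simp

theorem adamsCoeff_qHalf (k : ℕ+) : adamsCoeff k qHalf = qHalf ^ (k : ℤ) := by
  rw [qHalf_zpow, qInv_zpow]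
  refine HahnSeries.embDomain_single.trans ?_
  simp

/-- ψ_k(1/{1}) = 1/{k} = p_k(q^ρ). This is why Exp and Exp' of p_1/{1} are the Cauchy kernels
pairing the variables with q^ρ. -/
theorem adamsCoeff_inv_qInt_one (k : ℕ+) :
    adamsCoeff k (qInt 1)⁻¹ = powerSum (qRho ⊥) k := by
  rw [powerSum_qRho_bot k.ne_zero, map_inv₀, qInt, map_sub, map_zpow₀, map_zpow₀, adamsCoeff_qHalf,
    qInt, ← zpow_mul, ← zpow_mul, mul_one, mul_neg_one]

theorem adams_inv_qInt_one_smul_powerSum {f : ℕ → ℕ ⊕ ℕ} (hf : Function.Injective f) (k : ℕ+) :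
    adams k ((qInt 1)⁻¹ • powerSum (fun i => (X (f i) : Series)) 1) =
      C (powerSum (qRho ⊥) k) * powerSum (fun i => (X (f i) : Series)) k := by
  rw [adams_smul, adams_powerSum_X hf, adamsCoeff_inv_qInt_one, smul_eq_C_mul]

end Adams

/-! ### The two-leg vertex -/

section TwoLeg

open MvPowerSeries Filter Topology

instance : T3Space Series := inferInstance

theorem hSummable_varX : HSummable varX := hSummable_X Sum.inl_injective

theorem hSummable_varY : HSummable varY := hSummable_X Sum.inr_injective

theorem summable_varX_pow (k : ℕ+) : Summable fun i => varX i ^ (k : ℕ) :=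
  summable_X_pow Sum.inl_injective k.ne_zero

theorem summable_varY_pow (k : ℕ+) : Summable fun i => varY i ^ (k : ℕ) :=
  summable_X_pow Sum.inr_injective k.ne_zero

theorem constantCoeff_varX (i : ℕ) : constantCoeff (varX i) = 0 := constantCoeff_X _

theorem constantCoeff_varY (i : ℕ) : constantCoeff (varY i) = 0 := constantCoeff_X _

theorem tendsto_sum_C_qRho_pow (k : ℕ+) :
    Tendsto (fun N => ∑ j ∈ Finset.range N, (C (qRho ⊥ j) : Series) ^ (k : ℕ)) atTop
      (𝓝 (C (powerSum (qRho ⊥) k))) := by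
  have h := ((WithPiTopology.continuous_C (σ := ℕ ⊕ ℕ) (R := Coeff)).tendsto _).comp
    (summable_qRho_bot_pow k.ne_zero).hasSum.tendsto_sum_nat
  refine h.congr fun N => ?_
  rw [Function.comp_apply, map_sum]
  simp_rw [map_pow]

theorem tendsto_jacobiTrudi_C {F : ℕ → PowerSeries Coeff} {G : ℕ → PowerSeries Series}
    (hFG : ∀ N, G N = PowerSeries.map C (F N)) {l m : YoungDiagram} {c : Coeff}
    (h : Tendsto (fun N => jacobiTrudi (F N) N l m) atTop (𝓝 c)) :
    Tendsto (fun N => jacobiTrudi (G N) N l m) atTop (𝓝 (C c)) := by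
  refine (((WithPiTopology.continuous_C (σ := ℕ ⊕ ℕ) (R := Coeff)).tendsto c).comp h).congr
    fun N => ?_
  rw [hFG, jacobiTrudi_map, Function.comp_apply]

theorem isHomog_coeff_prod_geom_zero {σ R : Type*} [CommRing R] {w : σ → ℕ}
    {z : ℕ → MvPowerSeries σ R} (h : ∀ j, IsHomog w (z j) 0) (N k : ℕ) :
    IsHomog w (PowerSeries.coeff k (∏ j ∈ Finset.range N, geom (z j))) 0 := by
  have := isHomog_coeff_prod (Finset.range N) (fun j => isHomog_coeff_geom (h j)) k
  rwa [zero_mul] at this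

theorem isHomog_coeff_prod_one_add_zero {σ R : Type*} [CommRing R] {w : σ → ℕ}
    {z : ℕ → MvPowerSeries σ R} (h : ∀ j, IsHomog w (z j) 0) (N k : ℕ) :
    IsHomog w (PowerSeries.coeff k
      (∏ j ∈ Finset.range N, (1 + PowerSeries.C (z j) * PowerSeries.X))) 0 := by
  have := isHomog_coeff_prod (Finset.range N) (fun j => isHomog_coeff_one_add (h j)) k
  rwa [zero_mul] at this

/-- The skew Cauchy identity for the alphabets q^ρ and y, with kernel ∏ 1/(1 - q^{ρ_j} y_i). The
weight is the y-degree, for which scalars are homogeneous of weight 0. -/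
theorem hasSum_skewSchur_mul_schur_varY (η : YoungDiagram) :
    HasSum (fun l => C (skewSchur (qRho ⊥) l η) * schur varY l)
      (plethysticExp ((qInt 1)⁻¹ • powerSum varY 1) * schur varY η) := by
  refine hasSum_mul_schur (w := Sum.elim 0 1) (f := Sum.inr) Sum.inr_injective (fun _ => rfl)
    (G := fun N => ∏ j ∈ Finset.range N, geom (C (qRho ⊥ j)))
    (isHomog_coeff_prod_geom_zero fun j => isHomog_C (qRho ⊥ j))
    (fun N i => hasSum_eval_prod _ (constantCoeff_varY i)
      fun j => hasSum_eval_geom _ (constantCoeff_varY i)) ?_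
    fun l => tendsto_jacobiTrudi_C (F := fun N => ∏ j ∈ Finset.range N, geom (qRho ⊥ j)) ?_
      ((hSummable_qRho ⊥).tendsto_jacobiTrudi_prod_geom l η)
  · have h := tendsto_prod_expSeries (fun k => ((k : ℕ) : Coeff)⁻¹) constantCoeff_varY
      (fun k => (summable_varY_pow k).hasSum.tendsto_sum_nat) tendsto_sum_C_qRho_pow
    have hRHS : plethysticExp ((qInt 1)⁻¹ • powerSum varY 1) =
        expSeries (∑' k : ℕ+, ((k : ℕ) : Coeff)⁻¹ • (C (powerSum (qRho ⊥) k) *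
          ∑' i, varY i ^ (k : ℕ))) := by
      rw [plethysticExp]
      congr 2
      funext k
      exact congrArg _ (adams_inv_qInt_one_smul_powerSum Sum.inr_injective k)
    rw [hRHS]
    refine h.congr fun N => Finset.prod_congr rfl fun i _ => Finset.prod_congr rfl fun j _ => ?_
    exact expSeries_log_tsum_pow (by rw [map_mul, constantCoeff_varY, mul_zero])
  · intro N
    rw [map_prod]
    refine Finset.prod_congr rfl fun j _ => PowerSeries.ext fun k => ?_
    rw [PowerSeries.coeff_map, coeff_geom, coeff_geom, map_pow]

theorem hasSum_skewSchur_transpose_mul_schur_varX (η : YoungDiagram) :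
    HasSum (fun l => C (skewSchur (qRho ⊥) l.transpose η) * schur varX l)
      (plethysticExp' ((qInt 1)⁻¹ • powerSum varX 1) * schur varX η.transpose) := by
  refine hasSum_mul_schur (w := Sum.elim 1 0) (f := Sum.inl) Sum.inl_injective (fun _ => rfl)
    (G := fun N => ∏ j ∈ Finset.range N, (1 + PowerSeries.C (C (qRho ⊥ j)) * PowerSeries.X))
    (isHomog_coeff_prod_one_add_zero fun j => isHomog_C (qRho ⊥ j))
    (fun N i => hasSum_eval_prod _ (constantCoeff_varX i)
      fun j => hasSum_eval_one_add _ (varX i)) ?_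
    fun l => tendsto_jacobiTrudi_C (F := fun N => ∏ j ∈ Finset.range N,
      (1 + PowerSeries.C (qRho ⊥ j) * PowerSeries.X)) ?_ ?_
  · have h := tendsto_prod_expSeries (fun k => (-1) ^ ((k : ℕ) + 1) * ((k : ℕ) : Coeff)⁻¹)
      constantCoeff_varX
      (fun k => (summable_varX_pow k).hasSum.tendsto_sum_nat) tendsto_sum_C_qRho_pow
    have hRHS : plethysticExp' ((qInt 1)⁻¹ • powerSum varX 1) =
        expSeries (∑' k : ℕ+, ((-1) ^ ((k : ℕ) + 1) * ((k : ℕ) : Coeff)⁻¹) •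
          (C (powerSum (qRho ⊥) k) * ∑' i, varX i ^ (k : ℕ))) := by
      rw [plethysticExp']
      congr 2
      funext k
      exact congrArg _ (adams_inv_qInt_one_smul_powerSum Sum.inl_injective k)
    rw [hRHS]
    refine h.congr fun N => Finset.prod_congr rfl fun i _ => Finset.prod_congr rfl fun j _ => ?_
    exact expSeries_log_one_add (by rw [map_mul, constantCoeff_varX, mul_zero])
  · intro N
    rw [map_prod]
    refine Finset.prod_congr rfl fun j _ => ?_
    rw [map_add, map_one, map_mul, PowerSeries.map_C, PowerSeries.map_X]
  -- The dual kernel transposes both diagrams; starting from η^t restores η in the skew shape and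
  -- leaves s_{η^t}(x) outside.
  · have h := (hSummable_qRho ⊥).tendsto_jacobiTrudi_prod_one_add l η.transpose
    rwa [YoungDiagram.transpose_transpose] at h

/-- The dual Cauchy identity. The x_j act as parameters of the kernel ∏ (1 + x_j y_i), having weight
0 for the y-degree. -/
theorem hasSum_schur_transpose_mul_schur :
    HasSum (fun l => schur varX l.transpose * schur varY l)
      (plethysticExp' (powerSum varX 1 * powerSum varY 1)) := by
  have hbot : plethysticExp' (powerSum varX 1 * powerSum varY 1) =
      plethysticExp' (powerSum varX 1 * powerSum varY 1) * schur varY ⊥ := by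
    rw [schur, skewSchur_bot_bot, mul_one]
  rw [hbot]
  refine hasSum_mul_schur (w := Sum.elim 0 1) (f := Sum.inr) Sum.inr_injective (fun _ => rfl)
    (G := fun N => ∏ j ∈ Finset.range N, (1 + PowerSeries.C (varX j) * PowerSeries.X))
    (isHomog_coeff_prod_one_add_zero fun j => isHomog_X (Sum.inl j))
    (fun N i => hasSum_eval_prod _ (constantCoeff_varY i)
      fun j => hasSum_eval_one_add _ (varY i)) ?_ fun l => ?_
  · have h := tendsto_prod_expSeries (fun k => (-1) ^ ((k : ℕ) + 1) * ((k : ℕ) : Coeff)⁻¹)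
      constantCoeff_varY (fun k => (summable_varY_pow k).hasSum.tendsto_sum_nat)
      (fun k => (summable_varX_pow k).hasSum.tendsto_sum_nat)
    have hRHS : plethysticExp' (powerSum varX 1 * powerSum varY 1) =
        expSeries (∑' k : ℕ+, ((-1) ^ ((k : ℕ) + 1) * ((k : ℕ) : Coeff)⁻¹) •
          ((∑' i, varX i ^ (k : ℕ)) * ∑' i, varY i ^ (k : ℕ))) := by
      rw [plethysticExp']
      congr 2
      funext k
      rw [map_mul]
      exact congrArg _ (congrArg₂ _ (adams_powerSum_X Sum.inl_injective k)
        (adams_powerSum_X Sum.inr_injective k))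
    rw [hRHS]
    refine h.congr fun N => Finset.prod_congr rfl fun i _ => Finset.prod_congr rfl fun j _ => ?_
    exact expSeries_log_one_add (by rw [map_mul, constantCoeff_varY, mul_zero])
  · have h := hSummable_varX.tendsto_jacobiTrudi_prod_one_add l ⊥
    rwa [transpose_bot] at h

/-- The contribution of an intermediate diagram `η` to the term of `Z^{(-1, 0)}`. -/
def intermediateTerm (p : YoungDiagram × YoungDiagram × YoungDiagram) : Series :=
  C (skewSchur (qRho ⊥) p.2.1.transpose p.1) * schur varX p.2.1 *
    (C (skewSchur (qRho ⊥) p.2.2 p.1) * schur varY p.2.2)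

/-- The x-degree of a monomial determines |l| and the y-degree |m|, while s_{m/η} = 0 unless |η| ≤
|m|. -/
theorem finite_coeff_intermediateTerm_ne_zero (d : ℕ ⊕ ℕ →₀ ℕ) :
    {p | coeff d (intermediateTerm p) ≠ 0}.Finite := by
  set a := Finsupp.weight (Sum.elim 1 0 : ℕ ⊕ ℕ → ℕ) d
  set b := Finsupp.weight (Sum.elim 0 1 : ℕ ⊕ ℕ → ℕ) d
  refine (Finset.finite_toSet
    (diagramsCardLe b ×ˢ (diagramsCardLe a ×ˢ diagramsCardLe b))).subset ?_
  rintro ⟨η, l, m⟩ h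
  have h1 : IsHomog (Sum.elim 1 0) (intermediateTerm (η, l, m)) l.card := by
    have hx := isHomog_schur (w := Sum.elim 1 0) hSummable_varX (a := 1)
      (fun i => isHomog_X (Sum.inl i)) l
    have hy := isHomog_schur (w := Sum.elim 1 0) hSummable_varY (a := 0) (fun i => isHomog_X (Sum.inr i)) m
    simpa [intermediateTerm] using ((isHomog_C (skewSchur (qRho ⊥) l.transpose η)).mul hx).mul
      ((isHomog_C (skewSchur (qRho ⊥) m η)).mul hy)
  have h2 : IsHomog (Sum.elim 0 1) (intermediateTerm (η, l, m)) m.card := by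
    have hx := isHomog_schur (w := Sum.elim 0 1) hSummable_varX (a := 0)
      (fun i => isHomog_X (Sum.inl i)) l
    have hy := isHomog_schur (w := Sum.elim 0 1) hSummable_varY (a := 1) (fun i => isHomog_X (Sum.inr i)) m
    simpa [intermediateTerm] using ((isHomog_C (skewSchur (qRho ⊥) l.transpose η)).mul hx).mul
      ((isHomog_C (skewSchur (qRho ⊥) m η)).mul hy)
  have h3 : a = l.card := by_contra fun hn => h (h1.coeff_eq_zero d hn)
  have h4 : b = m.card := by_contra fun hn => h (h2.coeff_eq_zero d hn)
  have h5 : η.card ≤ m.card := by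
    by_contra hn
    refine h ?_
    rw [intermediateTerm, skewSchur_eq_zero_of_card_lt (qRho ⊥) (not_le.1 hn), map_zero, zero_mul,
      mul_zero, map_zero]
  rw [Finset.mem_coe, Finset.mem_product, Finset.mem_product, mem_diagramsCardLe,
    mem_diagramsCardLe, mem_diagramsCardLe, h3, h4]
  exact ⟨h5, le_rfl, le_rfl⟩

/-- Once the family is known to be summable, iterated summation identifies its sum. -/
theorem hasSum_prod_of_fiberwise {α β M : Type*} [AddCommMonoid M] [TopologicalSpace M]
    [ContinuousAdd M] [T3Space M] {f : α × β → M} {g : α → M} {a : M} (hf : Summable f)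
    (hfg : ∀ b, HasSum (fun c => f (b, c)) (g b)) (hg : HasSum g a) : HasSum f a := by
  rw [← (hf.hasSum.prod_fiberwise hfg).unique hg]
  exact hf.hasSum

theorem hasSum_intermediateTerm_mk_left (η : YoungDiagram) {f g : YoungDiagram → Series}
    (hf : f = fun l => C (skewSchur (qRho ⊥) l.transpose η) * schur varX l)
    (hg : g = fun l => C (skewSchur (qRho ⊥) l η) * schur varY l) {s t : Series}
    (hfs : HasSum f s) (hgt : HasSum g t) :
    HasSum (fun p => intermediateTerm (η, p)) (s * t) := by
  have h : (fun p => intermediateTerm (η, p)) =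
      fun p : YoungDiagram × YoungDiagram => f p.1 * g p.2 := by
    subst hf hg
    funext p
    rw [intermediateTerm]
  have hs : Summable fun p => intermediateTerm (η, p) :=
    summable_of_finite_coeff_ne_zero fun d =>
      (finite_coeff_intermediateTerm_ne_zero d).preimage
        (f := fun p => (η, p)) (Prod.mk_right_injective η).injOn
  rw [h] at hs ⊢
  exact hfs.mul hgt hs

theorem hasSum_intermediateTerm :
    HasSum intermediateTerm
      (plethysticExp' ((qInt 1)⁻¹ • powerSum varX 1) *
        plethysticExp ((qInt 1)⁻¹ • powerSum varY 1) *
        plethysticExp' (powerSum varX 1 * powerSum varY 1)) := by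
  refine hasSum_prod_of_fiberwise
    (summable_of_finite_coeff_ne_zero finite_coeff_intermediateTerm_ne_zero)
    (fun η => hasSum_intermediateTerm_mk_left η rfl rfl
      (hasSum_skewSchur_transpose_mul_schur_varX η) (hasSum_skewSchur_mul_schur_varY η)) ?_
  have h := hasSum_schur_transpose_mul_schur.mul_left
    (plethysticExp' ((qInt 1)⁻¹ • powerSum varX 1) * plethysticExp ((qInt 1)⁻¹ • powerSum varY 1))
  refine (congrArg (HasSum · _) (funext fun η => ?_)).mp h
  rw [mul_mul_mul_comm]

theorem hasSum_intermediateTerm_mk_right (p : YoungDiagram × YoungDiagram) :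
    HasSum (fun η => intermediateTerm (η, p)) (twoLegTerm (-1) 0 p) := by
  obtain ⟨l, m⟩ := p
  -- This n bounds both the first row of l and the number of rows of m. The box then contains every
  -- η with |η| ≤ |m|, so the finite sum in the key identity omits only zero terms.
  set n := l.card + m.card
  have hm : m ∈ boxDiagrams n (m.card + n) :=
    mem_boxDiagrams_of_card_le le_rfl ((colLen_zero_le_card m).trans (Nat.le_add_left _ _)) le_rfl
  have hv := framedVertex_eq_sum ((rowLen_zero_le_card l).trans (Nat.le_add_right l.card m.card))
    (mem_boxDiagrams.1 hm).1 (mem_boxDiagrams.1 hm).2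
  have hterm : twoLegTerm (-1) 0 (l, m) =
      ∑ η ∈ boxDiagrams n (m.card + n), intermediateTerm (η, l, m) := by
    rw [twoLegTerm, hv, smul_eq_C_mul, map_sum, Finset.sum_mul]
    refine Finset.sum_congr rfl fun η _ => ?_
    rw [intermediateTerm, map_mul]
    ring
  rw [hterm]
  refine hasSum_sum_of_ne_finset_zero fun η hη => ?_
  have h : m.card < η.card := by
    by_contra hn
    rw [not_lt] at hn
    exact hη (mem_boxDiagrams_of_card_le hn
      ((colLen_zero_le_card η).trans (hn.trans (Nat.le_add_left _ _))) le_rfl)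
  rw [intermediateTerm, skewSchur_eq_zero_of_card_lt (qRho ⊥) h, map_zero, zero_mul, mul_zero]

/-- The triple family, already summed with η outermost, is summed with η innermost; this gives
convergence of the two-leg series together with its value. -/
theorem hasSum_twoLegTerm :
    HasSum (twoLegTerm (-1) 0)
      (plethysticExp' ((qInt 1)⁻¹ • powerSum varX 1) *
        plethysticExp ((qInt 1)⁻¹ • powerSum varY 1) *
        plethysticExp' (powerSum varX 1 * powerSum varY 1)) := by
  have h := (Equiv.prodComm (YoungDiagram × YoungDiagram) YoungDiagram).hasSum_iff.2
    hasSum_intermediateTerm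
  exact h.prod_fiberwise hasSum_intermediateTerm_mk_right

end TwoLeg

end

end TopVertex


theorem proposition5p2 :
    Summable (TopVertex.twoLegTerm (-1) 0) ∧
    TopVertex.twoLegVertex (-1) 0 =
      TopVertex.plethysticExp' ((TopVertex.qInt 1)⁻¹ • TopVertex.powerSum TopVertex.varX 1) *
      TopVertex.plethysticExp ((TopVertex.qInt 1)⁻¹ • TopVertex.powerSum TopVertex.varY 1) *
      TopVertex.plethysticExp'
        (TopVertex.powerSum TopVertex.varX 1 * TopVertex.powerSum TopVertex.varY 1) :=
  ⟨TopVertex.hasSum_twoLegTerm.summable, TopVertex.hasSum_twoLegTerm.tsum_eq⟩
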